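/- Let $T$ be a compact metric space, and let $\mathbb C^+$ be the set of nonnegative continuous functions on $T$ with the uniform norm $\|x\|=\sup_{t\in T}|x(t)|$. For each $n\ge 1$ let $X_{1n},X_{2n},\ldots$ be independent copies of a random element $X_n$ of $\mathbb C^+$. Let $\mathbb S=\{x\in\mathbb C^+:\|x\|=1\}$ and $\overline{\mathbb C}{}_0^+=(0,\infty]\times\mathbb S$ with the metric $$d((r_1,s_1),(r_2,s_2))=|1/r_1-1/r_2|+\|s_1-s_2\| ,$$ and identify $\mathbb C_0^+=\mathbb C^+\setminus\{0\}$ with $(0,\infty)\times\mathbb S\subset\overline{\mathbb C}{}_0^+$ through $x\mapsto(\|x\|,x/\|x\|)$. Let $\nu$ be a Borel measure on $\overline{\mathbb C}{}_0^+$ that is finite on bounded sets, with $\nu(\overline{\mathbb C}{}_0^+\setminus\mathbb C_0^+)=0$, and assume that $$n\,\mathbb P[X_n\in\cdot\,]\to\nu\quad\sharp\text{-weakly on }\overline{\mathbb C}{}_0^+ ,$$ that is, $\int f\,d(n\,\mathbb P[X_n\in\cdot\,\cap\,\mathbb C_0^+])\to\int f\,d\nu$ for every bounded continuous $f:\overline{\mathbb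 C}{}_0^+\to\mathbb R$ with bounded support. For $j\ge 1$, $u\ge 0$ and $t\in T$ let $\tilde M_n^j(u,t)$ be the $j$-th largest value among $X_{1n}(t),\ldots,X_{[nu]n}(t)$, and $\tilde M_n^j(u,t)=0$ if $j>[nu]$. Let $\tilde\Pi_\nu$ be a Poisson point process on $\mathbb C_0^+\times[0,\infty)$ with intensity $\nu\otimes\ell$, where $\ell$ is the Lebesgue measure on $[0,\infty)$, and let $$\tilde M^j(u,t)=\sup\{y\ge 0:\ \tilde\Pi_\nu(B_{u,t}^y)\ge j\},\qquad B_{u,t}^y=\{(f,v)\in\mathbb C_0^+\times[0,\infty):\ f(t)\ge y,\ v\le u\},$$ with $\sup\emptyset=0$. Then, for every $r\ge 1$, $(\tilde M_n^1,\ldots,\tilde M_n^r)$ and $(\tilde M^1,\ldots,\tilde M^r)$ are random elements of the Skorokhod space $\mathbb D([0,\infty),(\mathbb C^+)^r)$ with the $J_1$-topology, and $(\tilde M_n^1,\ldots,\tilde M_n^r)$ converges weakly to $(\tilde M^1,\ldots,\tilde M^r)$ in $\mathbb D([0,\infty),(\mathbb C^+)^r)$ as $n\to\infty$. -/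

import Mathlib

open MeasureTheory ProbabilityTheory Filter Topology
open scoped NNReal ENNReal BoundedContinuousFunction

noncomputable section

/-! ### The space of nonnegative continuous functions and its compactification at infinity -/

/-- `C⁺(T)`: nonnegative continuous functions on the compact metric space `T`, with the uniform
metric. -/
abbrev CPlus (T : Type*) [TopologicalSpace T] : Type _ := C(T, ℝ≥0)

/-- The Borel σ-algebra of the uniform metric on `C⁺(T)`. -/
instance CPlus.instMeasurableSpace {T : Type*} [TopologicalSpace T] :
    MeasurableSpace C(T, ℝ≥0) := borel _

instance CPlus.instBorelSpace {T : Type*} [TopologicalSpace T] : BorelSpace C(T, ℝ≥0) := ⟨rfl⟩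

/-- The uniform norm `‖x‖ = sup_t x(t)` of `x ∈ C⁺(T)`. -/
def CPlus.supNorm {T : Type*} [TopologicalSpace T] (x : CPlus T) : ℝ≥0 := ⨆ t, x t

/-- The space `(0, ∞] × S`, where `S` is the unit sphere of `C⁺(T)`. -/
@[ext]
structure PolarSpace (T : Type*) [TopologicalSpace T] where
  radius : ℝ≥0∞
  radius_pos : 0 < radius
  angle : CPlus T
  supNorm_angle : angle.supNorm = 1

namespace PolarSpace

variable {T : Type*} [TopologicalSpace T] [CompactSpace T]

/-- The metric `d((r₁,s₁),(r₂,s₂)) = |1/r₁ - 1/r₂| + ‖s₁ - s₂‖`, with `1/∞ = 0`. -/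
instance instMetricSpace : MetricSpace (PolarSpace T) where
  dist p q := |(p.radius⁻¹).toReal - (q.radius⁻¹).toReal| + dist p.angle q.angle
  dist_self p := by simp
  dist_comm p q := by rw [abs_sub_comm, dist_comm]
  dist_triangle p q r := by
    have h₁ := abs_sub_le (p.radius⁻¹).toReal (q.radius⁻¹).toReal (r.radius⁻¹).toReal
    have h₂ := dist_triangle p.angle q.angle r.angle
    linarith
  eq_of_dist_eq_zero := by
    intro p q h
    have h₁ := abs_nonneg ((p.radius⁻¹).toReal - (q.radius⁻¹).toReal)
    have h₂ := dist_nonneg (x := p.angle) (y := q.angle)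
    have h₃ : |(p.radius⁻¹).toReal - (q.radius⁻¹).toReal| = 0 := by linarith
    have h₄ : dist p.angle q.angle = 0 := by linarith
    have h₅ : (p.radius⁻¹).toReal = (q.radius⁻¹).toReal := by
      rw [abs_eq_zero] at h₃
      linarith
    rw [ENNReal.toReal_eq_toReal_iff' (ENNReal.inv_ne_top.2 p.radius_pos.ne')
      (ENNReal.inv_ne_top.2 q.radius_pos.ne'), inv_inj] at h₅
    exact PolarSpace.ext h₅ (dist_eq_zero.1 h₄)

instance instMeasurableSpace : MeasurableSpace (PolarSpace T) := borel _

instance instBorelSpace : BorelSpace (PolarSpace T) := ⟨rfl⟩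

end PolarSpace

theorem CPlus.bddAbove_range {T : Type*} [TopologicalSpace T] [CompactSpace T] (x : CPlus T) :
    BddAbove (Set.range x) :=
  (isCompact_range x.continuous).bddAbove

theorem CPlus.supNorm_ne_zero {T : Type*} [TopologicalSpace T] [CompactSpace T] {x : CPlus T}
    (hx : x ≠ 0) : x.supNorm ≠ 0 := by
  intro h
  refine hx (ContinuousMap.ext fun t => ?_)
  have h₁ : x t ≤ x.supNorm := le_ciSup x.bddAbove_range t
  rw [h] at h₁
  simpa using h₁

/-- The polar decomposition `x ↦ (‖x‖, x / ‖x‖)` on `C₀⁺ = C⁺ \ {0}`. -/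
def polar {T : Type*} [TopologicalSpace T] [CompactSpace T] (x : {x : CPlus T // x ≠ 0}) :
    PolarSpace T where
  radius := (x.1.supNorm : ℝ≥0∞)
  radius_pos := by
    have := CPlus.supNorm_ne_zero x.2
    exact_mod_cast pos_iff_ne_zero.2 this
  angle := ⟨fun t => x.1 t / x.1.supNorm, x.1.continuous.div_const _⟩
  supNorm_angle := by
    have h := CPlus.supNorm_ne_zero x.2
    have h₁ : (⨆ t, x.1 t / x.1.supNorm) = (⨆ t, x.1 t) / x.1.supNorm :=
      (NNReal.iSup_div _ _).symm
    exact h₁.trans (div_self h)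

/-- A measure on `C⁺`, restricted to `C₀⁺ = C⁺ \ {0}` and carried over to `(0, ∞] × S` by the
polar decomposition. -/
def polarMeasure {T : Type*} [TopologicalSpace T] [CompactSpace T] (μ : Measure (CPlus T)) :
    Measure (PolarSpace T) :=
  (μ.comap (Subtype.val : {x : CPlus T // x ≠ 0} → CPlus T)).map polar

/-! ### Boundedly finite measures and point processes -/

/-- A measure is boundedly finite if bounded measurable sets have finite measure. -/
def IsBoundedlyFinite {E : Type*} [PseudoMetricSpace E] [MeasurableSpace E] (μ : Measure E) :
    Prop :=
  ∀ B : Set E, Bornology.IsBounded B → MeasurableSet B → μ B < ∞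

/-- `♯`-weak convergence: convergence of the integrals of all bounded continuous functions with
bounded support. -/
def TendstoSharpWeakly {E : Type*} [PseudoMetricSpace E] [MeasurableSpace E]
    (μs : ℕ → Measure E) (μ : Measure E) : Prop :=
  ∀ f : E →ᵇ ℝ, Bornology.IsBounded (Function.support f) →
    Tendsto (fun n => ∫ x, f x ∂(μs n)) atTop (𝓝 (∫ x, f x ∂μ))

/-- A boundedly finite point measure: `μ = ∑_{i ∈ I} δ_{x i}` for an at most countable family of
points, of which every bounded set contains only finitely many. -/
def IsBoundedlyFinitePointMeasure {E : Type*} [PseudoMetricSpace E] [MeasurableSpace E]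
    (μ : Measure E) : Prop :=
  ∃ (I : Set ℕ) (x : I → E), (∀ B : Set E, Bornology.IsBounded B → {i | x i ∈ B}.Finite) ∧
    μ = Measure.sum fun i => Measure.dirac (x i)

/-- `N` is a (boundedly finite) Poisson point process on `E` with intensity `ν`, defined on the
probability space `(Ω, P)`. -/
structure IsPoissonPointProcess {Ω E : Type*} [MeasurableSpace Ω] [PseudoMetricSpace E]
    [MeasurableSpace E] (N : Ω → Measure E) (ν : Measure E) (P : Measure Ω) : Prop where
  measurable : Measurable N
  pointMeasure : ∀ ω, IsBoundedlyFinitePointMeasure (N ω)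
  law : ∀ A : Set E, MeasurableSet A → ν A ≠ ∞ →
    P.map (fun ω => N ω A) = (poissonMeasure (ν A).toNNReal).map (Nat.cast : ℕ → ℝ≥0∞)
  indep : ∀ (k : ℕ) (A : Fin k → Set E), (∀ i, MeasurableSet (A i)) →
    Pairwise (Function.onFun Disjoint A) → iIndepFun (fun i ω => N ω (A i)) P

/-- Lebesgue measure on `[0, ∞)`. -/
def lebesgueHalfLine : Measure ℝ≥0 := (volume : Measure ℝ).comap ((↑) : ℝ≥0 → ℝ)

/-! ### The Skorokhod space `D([0, ∞), E)` -/

/-- Càdlàg functions `[0, ∞) → E`. -/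
@[ext]
structure SkorokhodSpace (E : Type*) [TopologicalSpace E] where
  toFun : ℝ≥0 → E
  right_continuous : ∀ u, ContinuousWithinAt toFun (Set.Ici u) u
  left_limits : ∀ u, ∃ l, Tendsto toFun (𝓝[<] u) (𝓝 l)

namespace SkorokhodSpace

variable {E : Type*} [PseudoMetricSpace E]

instance : CoeFun (SkorokhodSpace E) (fun _ => ℝ≥0 → E) := ⟨toFun⟩

/-- Pairs `(x, y)` of paths such that, for some increasing bijection `τ` of `[0, ∞)`, one has
`|τ(u) - u| ≤ ε` and `d(x(u), y(τ(u))) ≤ ε` for all `u ∈ [0, a]`. -/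
def entourage (E : Type*) [PseudoMetricSpace E] (a ε : ℝ≥0) :
    Set (SkorokhodSpace E × SkorokhodSpace E) :=
  {p | ∃ τ : ℝ≥0 ≃o ℝ≥0, ∀ u ≤ a, dist (τ u) u ≤ ε ∧ dist (p.1 u) (p.2 (τ u)) ≤ ε}

theorem entourage_mono {a b δ ε : ℝ≥0} (hab : a ≤ b) (hδ : δ ≤ ε) :
    entourage E b δ ⊆ entourage E a ε := by
  rintro p ⟨τ, h⟩
  refine ⟨τ, fun u hu => ?_⟩
  obtain ⟨h₁, h₂⟩ := h u (hu.trans hab)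
  exact ⟨h₁.trans (by exact_mod_cast hδ), h₂.trans (by exact_mod_cast hδ)⟩

/-- The sets `entourage E a ε`, `a ≥ 0`, `ε > 0`, form a filter basis. -/
def entourageBasis (E : Type*) [PseudoMetricSpace E] :
    FilterBasis (SkorokhodSpace E × SkorokhodSpace E) where
  sets := {s | ∃ a ε : ℝ≥0, 0 < ε ∧ s = entourage E a ε}
  nonempty := ⟨_, 0, 1, one_pos, rfl⟩
  inter_sets := by
    rintro _ _ ⟨a, ε, hε, rfl⟩ ⟨b, δ, hδ, rfl⟩
    exact ⟨_, ⟨max a b, min ε δ, lt_min hε hδ, rfl⟩, Set.subset_inter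
      (entourage_mono (le_max_left _ _) (min_le_left _ _))
      (entourage_mono (le_max_right _ _) (min_le_right _ _))⟩

/-- The uniform structure generated by the sets `entourage E a ε`, `a ≥ 0`, `ε > 0`. Its topology
is Skorokhod's `J₁`-topology: `xₙ → x` if and only if for every `a` there are increasing
bijections `τₙ` of `[0, ∞)` with `sup_{u ≤ a} |τₙ(u) - u| → 0` and
`sup_{u ≤ a} d(xₙ(u), x(τₙ(u))) → 0`. -/
instance instUniformSpace : UniformSpace (SkorokhodSpace E) :=
  UniformSpace.ofCore <| UniformSpace.Core.mkOfBasis (entourageBasis E)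
    (by
      rintro _ ⟨a, ε, hε, rfl⟩ x
      exact ⟨OrderIso.refl _, fun u _ => by simp⟩)
    (by
      rintro _ ⟨a, ε, hε, rfl⟩
      refine ⟨_, ⟨a + ε, ε, hε, rfl⟩, ?_⟩
      rintro ⟨x, y⟩ ⟨τ, h⟩
      refine ⟨τ.symm, fun u hu => ?_⟩
      have hu' : τ.symm u ≤ a + ε := by
        rw [OrderIso.symm_apply_le]
        refine hu.trans ?_
        have h₁ := (h (a + ε) le_rfl).1
        rw [NNReal.dist_eq, NNReal.coe_add] at h₁
        have h₂ := (abs_le.1 h₁).1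
        rw [← NNReal.coe_le_coe]
        linarith
      obtain ⟨h₁, h₂⟩ := h _ hu'
      rw [OrderIso.apply_symm_apply] at h₁ h₂
      exact ⟨by rwa [dist_comm], by rwa [dist_comm]⟩)
    (by
      rintro _ ⟨a, ε, hε, rfl⟩
      refine ⟨_, ⟨a + ε, ε / 2, half_pos hε, rfl⟩, ?_⟩
      rintro ⟨x, z⟩ ⟨y, ⟨τ, h⟩, ⟨σ, k⟩⟩
      refine ⟨τ.trans σ, fun u hu => ?_⟩
      obtain ⟨h₁, h₂⟩ := h u (hu.trans le_self_add)
      have hτ : τ u ≤ a + ε := by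
        have h₃ := h₁
        rw [NNReal.dist_eq, NNReal.coe_div, NNReal.coe_ofNat] at h₃
        replace h₃ := (abs_le.1 h₃).2
        have hu' : (u : ℝ) ≤ a := by exact_mod_cast hu
        have hε' : (0 : ℝ) < ε := by exact_mod_cast hε
        rw [← NNReal.coe_le_coe]
        rw [NNReal.coe_add]
        linarith
      obtain ⟨k₁, k₂⟩ := k _ hτ
      have h₄ := dist_triangle (σ (τ u)) (τ u) u
      have h₅ := dist_triangle (x u) (y (τ u)) (z (σ (τ u)))
      push_cast at h₁ h₂ k₁ k₂
      exact ⟨by simp only [OrderIso.trans_apply]; linarith,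
        by simp only [OrderIso.trans_apply]; linarith⟩)

/-- The Borel σ-algebra of the `J₁`-topology. -/
instance instMeasurableSpace : MeasurableSpace (SkorokhodSpace E) := borel _

instance instBorelSpace : BorelSpace (SkorokhodSpace E) := ⟨rfl⟩

end SkorokhodSpace

/-! ### Order statistics -/

/-- The `(j+1)`-th largest element of the finite family (multiset) `s`, and `0` if `s` has at most
`j` elements. -/
def nthLargest (s : Multiset ℝ≥0) (j : ℕ) : ℝ≥0 := (s.sort (· ≥ ·)).getD j 0

/-- The set `B_{u,t}^y` of pairs `(f, v) ∈ C₀⁺ × [0, ∞)` with `f(t) ≥ y` and `v ≤ u`, where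
`f ∈ C₀⁺` is written as `f = r s` with `0 < r < ∞` and `s` in the unit sphere. -/
def exceedanceSet {T : Type*} [TopologicalSpace T] (u : ℝ≥0) (t : T) (y : ℝ≥0) :
    Set (PolarSpace T × ℝ≥0) :=
  {p | p.1.radius ≠ ∞ ∧ (y : ℝ≥0∞) ≤ p.1.radius * (p.1.angle t : ℝ≥0∞) ∧ p.2 ≤ u}

/-- The `(j+1)`-th space-time order statistic `sup {y ≥ 0 : μ(B_{u,t}^y) ≥ j + 1}` of a point
measure `μ`; the supremum of the empty set is `0`. -/
def spaceTimeOrderStat {T : Type*} [TopologicalSpace T] [CompactSpace T]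
    (μ : Measure (PolarSpace T × ℝ≥0)) (j : ℕ) (u : ℝ≥0) (t : T) : ℝ≥0 :=
  sSup {y : ℝ≥0 | ((j + 1 : ℕ) : ℝ≥0∞) ≤ μ (exceedanceSet u t y)}

end

/-!
The order statistics up to time `u` are a functional of a family of marked functions `(f, v)`, and
members with `‖f‖ ≤ ε` change them by at most `ε`. Cut time into cells of irrational length `h`, so
that no time `(i + 1) / n` of the array lies on the grid, and the functions of norm larger than `ε`,
up to a set of small `ν`-measure, into finitely many cells of small diameter whose boundaries are
`ν`-null. With high probability no time cell holds more than one large function, and then the path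
is within `J₁`-distance `ε` of a step path which depends only on the pattern recording which cell of
functions is hit in each time cell. The number of large functions of the array in a time cell is
binomial, so the pattern probabilities of the array converge to those of the Poisson process. Two
families of paths which are close to common finitely valued ones, with converging probabilities of
the values, converge in distribution; this also makes the limit path almost everywhere measurable.
-/

noncomputable section

/-! ### Order statistics -/

section OrderStat

variable {ι κ : Type*} {s : Set ι} {s' : Set κ} {a : ι → ℝ≥0} {b : κ → ℝ≥0} {ε : ℝ≥0}
  {R : ι → κ → Prop}

/-- The `(j+1)`-th largest member of the family `(a i)`, `i ∈ s`, and `0` if `s` has at most `j`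
elements. The definition is meant for families of which only finitely many members exceed a given
positive level. -/
def orderStat (s : Set ι) (a : ι → ℝ≥0) (j : ℕ) : ℝ≥0 :=
  sSup {y | ((j + 1 : ℕ) : ℕ∞) ≤ {i ∈ s | y ≤ a i}.encard}

theorem orderStat_le_orderStat_add (hb : BddAbove (b '' s')) (hR : Relator.LeftUnique R)
    (h : ∀ i ∈ s, ε < a i → ∃ k ∈ s', R i k ∧ dist (a i) (b k) ≤ ε) (j : ℕ) :
    orderStat s a j ≤ orderStat s' b j + ε := by
  refine csSup_le' fun y hy => ?_
  rcases le_or_gt y ε with hyε | hyε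
  · exact hyε.trans le_add_self
  rw [← tsub_le_iff_right]
  refine le_csSup ?_ ?_
  · obtain ⟨C, hC⟩ := hb
    refine ⟨C, fun z hz => ?_⟩
    obtain ⟨k, hk, hzk⟩ : {k ∈ s' | z ≤ b k}.Nonempty :=
      Set.encard_pos.1 (lt_of_lt_of_le (by simp) hz)
    exact hzk.trans (hC ⟨k, hk, rfl⟩)
  · have hmatch : ∀ i : {i ∈ s | y ≤ a i}, ∃ k ∈ s', R i k ∧ dist (a i) (b k) ≤ ε :=
      fun i => h i i.2.1 (hyε.trans_le i.2.2)
    choose k hks hRk hk using hmatch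
    have hinj : Function.Injective k :=
      fun i i' hii => Subtype.ext (hR (hRk i) (hii ▸ hRk i'))
    refine le_trans (Set.mem_ofPred.1 hy) ?_
    rw [Set.encard, ENat.card_congr (Equiv.ofInjective k hinj)]
    refine Set.encard_le_encard ?_
    rintro _ ⟨i, rfl⟩
    have hdist := (abs_le.1 ((NNReal.dist_eq _ _).symm.trans_le (hk i))).2
    refine ⟨hks i, tsub_le_iff_right.2 (i.2.2.trans ?_)⟩
    exact NNReal.coe_le_coe.1 (by push_cast; linarith)

theorem biUnique_eq {α : Type*} : Relator.BiUnique (Eq : α → α → Prop) :=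
  ⟨fun _ _ _ h h' => h.trans h'.symm, fun _ _ _ h h' => h.symm.trans h'⟩

theorem dist_orderStat_le (ha : BddAbove (a '' s)) (hb : BddAbove (b '' s'))
    (hR : Relator.BiUnique R)
    (h : ∀ i ∈ s, ε < a i → ∃ k ∈ s', R i k ∧ dist (a i) (b k) ≤ ε)
    (h' : ∀ k ∈ s', ε < b k → ∃ i ∈ s, R i k ∧ dist (a i) (b k) ≤ ε) (j : ℕ) :
    dist (orderStat s a j) (orderStat s' b j) ≤ ε := by
  have h₁ := orderStat_le_orderStat_add hb hR.1 h j
  have h₂ := orderStat_le_orderStat_add (R := flip R) ha (fun _ _ _ hk hk' => hR.2 hk hk')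
    (fun k hk hεk => by simpa only [flip, dist_comm] using h' k hk hεk) j
  rw [NNReal.dist_eq, abs_sub_le_iff, sub_le_iff_le_add', sub_le_iff_le_add']
  exact_mod_cast And.intro h₁ h₂

theorem sSup_eq_sSup_of_forall_pos {A B : Set ℝ≥0} (h : ∀ y, 0 < y → (y ∈ A ↔ y ∈ B)) :
    sSup A = sSup B := by
  have hzero : ∀ A : Set ℝ≥0, sSup (insert 0 A) = sSup A := by
    intro A
    by_cases hA : BddAbove A
    · rcases A.eq_empty_or_nonempty with rfl | hne
      · simp
      · rw [csSup_insert hA hne, sup_eq_right]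
        exact zero_le
    · rw [NNReal.sSup_of_not_bddAbove hA,
        NNReal.sSup_of_not_bddAbove (mt (BddAbove.mono (Set.subset_insert _ _)) hA)]
  rw [← hzero A, ← hzero B]
  congr 1
  ext y
  rcases eq_or_ne y 0 with rfl | hy
  · simp
  · simp [hy, h y (pos_iff_ne_zero.2 hy)]

theorem lt_countP_iff_le_getD {l : List ℝ≥0} (hl : l.Pairwise (· ≥ ·)) {y : ℝ≥0} (hy : 0 < y)
    (j : ℕ) : j < l.countP (fun z => y ≤ z) ↔ y ≤ l.getD j 0 := by
  induction l generalizing j with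
  | nil => exact iff_of_false (Nat.not_lt_zero j) hy.not_ge
  | cons z l ih =>
    rw [List.pairwise_cons] at hl
    by_cases hz : y ≤ z
    · rw [List.countP_cons_of_pos (by simpa using hz)]
      cases j with
      | zero => exact iff_of_true (Nat.succ_pos _) hz
      | succ j => simpa using ih hl.2 j
    · have hlt : ∀ z' ∈ l, z' < y := fun z' hz' => (hl.1 z' hz').trans_lt (not_le.1 hz)
      have hcount : l.countP (fun z => y ≤ z) = 0 := by simpa using hlt
      rw [List.countP_cons_of_neg (by simpa using hz), hcount]
      refine iff_of_false (by simp) ?_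
      cases j with
      | zero => exact hz
      | succ j => simpa [hcount] using (ih hl.2 j).not

theorem nthLargest_map_val (s : Finset ι) (a : ι → ℝ≥0) (j : ℕ) :
    nthLargest (s.val.map a) j = orderStat s a j := by
  rw [← csSup_Iic (a := nthLargest (s.val.map a) j), orderStat]
  refine sSup_eq_sSup_of_forall_pos fun y hy => ?_
  have hset : {i | i ∈ (s : Set ι) ∧ y ≤ a i} = (s.filter fun i => y ≤ a i : Finset ι) := by
    ext i
    simp
  rw [Set.mem_Iic, nthLargest, ← lt_countP_iff_le_getD (Multiset.pairwise_sort _ _) hy,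
    ← Multiset.coe_countP, Multiset.sort_eq, Multiset.countP_map, Set.mem_ofPred_eq, hset,
    Set.encard_coe_eq_coe_finsetCard, Nat.cast_le, Nat.succ_le_iff]
  rfl

end OrderStat

/-! ### Order statistics of families of functions -/

section Families

variable {ι κ T : Type*} [TopologicalSpace T] {s s' : Set ι} {s'' : Set κ}
  {f : ι → CPlus T} {g : κ → CPlus T}

/-- Only finitely many of the functions `f i`, `i ∈ s`, exceed a given positive level. -/
def FinitelyLarge (s : Set ι) (f : ι → CPlus T) : Prop :=
  ∀ ε : ℝ≥0, 0 < ε → {i ∈ s | ∃ t, ε < f i t}.Finite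

theorem FinitelyLarge.bddAbove (hf : FinitelyLarge s f) (t : T) :
    BddAbove ((fun i => f i t) '' s) := by
  refine ((((hf 1 one_pos).image fun i => f i t).bddAbove).union (bddAbove_Iic (a := 1))).mono ?_
  rintro _ ⟨i, hi, rfl⟩
  rcases le_or_gt (f i t) 1 with h | h
  · exact Or.inr h
  · exact Or.inl ⟨i, ⟨hi, t, h⟩, rfl⟩

/-- The pointwise `(j+1)`-th order statistic of a family of functions. -/
def orderStatFun (hf : FinitelyLarge s f) (j : ℕ) : CPlus T where
  toFun t := orderStat s (fun i => f i t) j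
  continuous_toFun := by
    refine continuous_iff_continuousAt.2 fun t =>
      Metric.nhds_basis_closedBall.tendsto_right_iff.2 fun ε hε => ?_
    lift ε to ℝ≥0 using hε.le
    have hnear : ∀ᶠ t' in 𝓝 t, ∀ i ∈ {i ∈ s | ∃ t, ε < f i t}, dist (f i t') (f i t) ≤ ε :=
      (eventually_all_finite (hf ε (by exact_mod_cast hε))).2 fun i _ =>
        Metric.nhds_basis_closedBall.tendsto_right_iff.1 ((f i).continuous.tendsto t) ε hε
    filter_upwards [hnear] with t' ht'
    exact dist_orderStat_le (R := Eq) (hf.bddAbove t') (hf.bddAbove t) biUnique_eq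
      (fun i hi hεi => ⟨i, hi, rfl, ht' i ⟨hi, t', hεi⟩⟩)
      (fun i hi hεi => ⟨i, hi, rfl, ht' i ⟨hi, t, hεi⟩⟩) j

theorem dist_orderStatFun_le [CompactSpace T] {ε : ℝ≥0} {R : ι → κ → Prop} (hf : FinitelyLarge s f)
    (hg : FinitelyLarge s'' g) (hR : Relator.BiUnique R)
    (h : ∀ i ∈ s, (∃ t, ε < f i t) → ∃ k ∈ s'', R i k ∧ dist (f i) (g k) ≤ ε)
    (h' : ∀ k ∈ s'', (∃ t, ε < g k t) → ∃ i ∈ s, R i k ∧ dist (f i) (g k) ≤ ε) (j : ℕ) :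
    dist (orderStatFun hf j) (orderStatFun hg j) ≤ ε := by
  refine (ContinuousMap.dist_le ε.2).2 fun t => ?_
  refine dist_orderStat_le (hf.bddAbove t) (hg.bddAbove t) hR ?_ ?_ j
  · intro i hi hεi
    obtain ⟨k, hk, hRk, hdist⟩ := h i hi ⟨t, hεi⟩
    exact ⟨k, hk, hRk, (ContinuousMap.dist_apply_le_dist t).trans hdist⟩
  · intro k hk hεk
    obtain ⟨i, hi, hRi, hdist⟩ := h' k hk ⟨t, hεk⟩
    exact ⟨i, hi, hRi, (ContinuousMap.dist_apply_le_dist t).trans hdist⟩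

theorem dist_orderStatFun_le_of_mem_iff [CompactSpace T] {ε : ℝ≥0} (hf : FinitelyLarge s f)
    (hf' : FinitelyLarge s' f) (h : ∀ i, (∃ t, ε < f i t) → (i ∈ s ↔ i ∈ s')) (j : ℕ) :
    dist (orderStatFun hf j) (orderStatFun hf' j) ≤ ε :=
  dist_orderStatFun_le (R := Eq) hf hf' biUnique_eq
    (fun i hi hεi => ⟨i, (h i hεi).1 hi, rfl, by simp⟩)
    (fun i hi hεi => ⟨i, (h i hεi).2 hi, rfl, by simp⟩) j

end Families

section Paths

variable {ι T : Type*} [TopologicalSpace T] {x : ι → CPlus T × ℝ≥0} {ε : ℝ≥0}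

/-- Up to any time, only finitely many of the functions `(x i).1`, occurring at the times
`(x i).2`, exceed a given positive level. -/
def LocallyFinitelyLarge (x : ι → CPlus T × ℝ≥0) : Prop :=
  ∀ u, FinitelyLarge {i | (x i).2 ≤ u} fun i => (x i).1

theorem LocallyFinitelyLarge.of_finite [Finite ι] (x : ι → CPlus T × ℝ≥0) :
    LocallyFinitelyLarge x :=
  fun _ _ _ => Set.toFinite _

theorem LocallyFinitelyLarge.finitelyLarge_lt (hx : LocallyFinitelyLarge x) (u : ℝ≥0) :
    FinitelyLarge {i | (x i).2 < u} fun i => (x i).1 :=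
  fun ε hε => (hx u ε hε).subset fun _ ⟨hi, hεi⟩ => ⟨le_of_lt (Set.mem_ofPred.1 hi), hεi⟩

theorem LocallyFinitelyLarge.eventually_nhdsGE (hx : LocallyFinitelyLarge x) (hε : 0 < ε)
    (u : ℝ≥0) :
    ∀ᶠ w in 𝓝[≥] u, ∀ i, (∃ t, ε < (x i).1 t) → ((x i).2 ≤ w ↔ (x i).2 ≤ u) := by
  have hfinite : ∀ᶠ w in 𝓝[≥] u, ∀ i ∈ {i | (x i).2 ≤ u + 1 ∧ ∃ t, ε < (x i).1 t},
      u < (x i).2 → w < (x i).2 :=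
    (eventually_all_finite (hx (u + 1) ε hε)).2 fun i _ =>
      eventually_imp_distrib_left.2 fun hi =>
        eventually_nhdsWithin_of_eventually_nhds (eventually_lt_nhds hi)
  filter_upwards [hfinite, self_mem_nhdsWithin, eventually_nhdsWithin_of_eventually_nhds
    (eventually_lt_nhds (lt_add_one u))] with w hw huw hwu i hi
  refine ⟨fun hiw => ?_, fun hiu => hiu.trans huw⟩
  by_contra! hui
  exact (hw i ⟨hiw.trans hwu.le, hi⟩ hui).not_ge hiw

theorem LocallyFinitelyLarge.eventually_nhdsLT (hx : LocallyFinitelyLarge x) (hε : 0 < ε)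
    (u : ℝ≥0) :
    ∀ᶠ w in 𝓝[<] u, ∀ i, (∃ t, ε < (x i).1 t) → ((x i).2 ≤ w ↔ (x i).2 < u) := by
  have hfinite : ∀ᶠ w in 𝓝[<] u, ∀ i ∈ {i | (x i).2 ≤ u ∧ ∃ t, ε < (x i).1 t},
      (x i).2 < u → (x i).2 < w :=
    (eventually_all_finite (hx u ε hε)).2 fun i _ =>
      eventually_imp_distrib_left.2 fun hi =>
        eventually_nhdsWithin_of_eventually_nhds (eventually_gt_nhds hi)
  filter_upwards [hfinite, self_mem_nhdsWithin] with w hw hwu i hi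
  exact ⟨fun hiw => hiw.trans_lt hwu, fun hiu => (hw i ⟨hiu.le, hi⟩ hiu).le⟩

/-- The path whose value at time `u` consists of the first `r` order statistics of the functions
occurring in `[0, u]`. -/
def orderPath [CompactSpace T] (hx : LocallyFinitelyLarge x) (r : ℕ) :
    SkorokhodSpace (Fin r → CPlus T) where
  toFun u j := orderStatFun (hx u) j
  right_continuous u := by
    refine tendsto_pi_nhds.2 fun j =>
      Metric.nhds_basis_closedBall.tendsto_right_iff.2 fun ε hε => ?_
    lift ε to ℝ≥0 using hε.le
    filter_upwards [hx.eventually_nhdsGE (by exact_mod_cast hε) u] with w hw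
    exact dist_orderStatFun_le_of_mem_iff _ _ hw j
  left_limits u := by
    refine ⟨fun j => orderStatFun (hx.finitelyLarge_lt u) j, tendsto_pi_nhds.2 fun j =>
      Metric.nhds_basis_closedBall.tendsto_right_iff.2 fun ε hε => ?_⟩
    lift ε to ℝ≥0 using hε.le
    filter_upwards [hx.eventually_nhdsLT (by exact_mod_cast hε) u] with w hw
    exact dist_orderStatFun_le_of_mem_iff _ _ hw j

theorem orderPath_apply [CompactSpace T] (hx : LocallyFinitelyLarge x) {r : ℕ} (u : ℝ≥0)
    (j : Fin r) (t : T) :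
    orderPath hx r u j t = orderStat {i | (x i).2 ≤ u} (fun i => (x i).1 t) j :=
  rfl

end Paths

/-! ### Time cells and time changes -/

section TimeCells

variable {h u : ℝ≥0} {b b' : ℕ}

/-- The `b`-th cell of the partition of `(0, ∞)` into half-open intervals of length `h`. -/
def timeCell (h : ℝ≥0) (b : ℕ) : Set ℝ≥0 := Set.Ioc (b * h) ((b + 1) * h)

theorem measurableSet_timeCell : MeasurableSet (timeCell h b) := measurableSet_Ioc

theorem exists_mem_timeCell (hh : 0 < h) (hu : 0 < u) : ∃ b, u ∈ timeCell h b := by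
  have hceil : 0 < ⌈u / h⌉₊ := Nat.ceil_pos.2 (div_pos hu hh)
  refine ⟨⌈u / h⌉₊ - 1, ?_, ?_⟩
  · rw [← lt_div_iff₀ hh]
    exact Nat.lt_ceil.1 (Nat.sub_lt hceil one_pos)
  · rw [← div_le_iff₀ hh, ← Nat.cast_add_one, Nat.sub_add_cancel hceil]
    exact Nat.le_ceil _

theorem le_of_mem_timeCell (hu : u ∈ timeCell h b) (hu' : u ≤ b' * h) : b + 1 ≤ b' := by
  have hlt : (b : ℝ≥0) * h < b' * h := hu.1.trans_le hu'
  exact_mod_cast lt_of_mul_lt_mul_right hlt zero_le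

theorem timeCell_unique (hu : u ∈ timeCell h b) (hu' : u ∈ timeCell h b') : b = b' := by
  have h₁ : b + 1 ≤ b' + 1 := le_of_mem_timeCell hu (by exact_mod_cast hu'.2)
  have h₂ : b' + 1 ≤ b + 1 := le_of_mem_timeCell hu' (by exact_mod_cast hu.2)
  omega

theorem pairwise_disjoint_timeCell (h : ℝ≥0) : Pairwise (Function.onFun Disjoint (timeCell h)) :=
  fun _ _ hb => Set.disjoint_left.2 fun _ hu hu' => hb (timeCell_unique hu hu')

/-- The midpoint of the `b`-th time cell. -/
def timeMid (h : ℝ≥0) (b : ℕ) : ℝ≥0 := (b + 2⁻¹) * h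

theorem timeMid_mem_Ioo (hh : 0 < h) (b : ℕ) : timeMid h b ∈ Set.Ioo (b * h) ((b + 1) * h) := by
  have hhalf : (2⁻¹ : ℝ≥0) < 1 := inv_lt_one_of_one_lt₀ one_lt_two
  constructor
  · exact mul_lt_mul_of_pos_right (lt_add_of_pos_right _ (by positivity)) hh
  · exact mul_lt_mul_of_pos_right (by gcongr) hh

theorem exists_nnreal_orderIso {f : ℝ → ℝ} (hmono : StrictMono f)
    (hsurj : Function.Surjective f) (h0 : f 0 = 0) :
    ∃ σ : ℝ≥0 ≃o ℝ≥0, ∀ x : ℝ≥0, (σ x : ℝ) = f x := by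
  have hnonneg : ∀ x : ℝ≥0, 0 ≤ f x := fun x => h0 ▸ hmono.monotone x.2
  let g : ℝ≥0 → ℝ≥0 := fun x => ⟨f x, hnonneg x⟩
  have hg : StrictMono g := fun x y hxy => NNReal.coe_lt_coe.1 (hmono (NNReal.coe_lt_coe.2 hxy))
  have hgsurj : Function.Surjective g := by
    intro y
    obtain ⟨x, hx⟩ := hsurj y
    have hx0 : 0 ≤ x := by
      rw [← hmono.le_iff_le, h0, hx]
      exact y.2
    exact ⟨⟨x, hx0⟩, NNReal.coe_injective hx⟩
  exact ⟨hg.orderIsoOfSurjective g hgsurj, fun x => rfl⟩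

theorem exists_orderIso_bump_of_le {c d v w : ℝ≥0} (hcv : c < v) (hvd : v < d) (hcw : c < w)
    (hwv : w ≤ v) :
    ∃ σ : ℝ≥0 ≃o ℝ≥0, σ v = w ∧ (∀ x ≤ c, σ x = x) ∧ ∀ x, d ≤ x → σ x = x := by
  rw [← NNReal.coe_lt_coe] at hcv hvd hcw
  rw [← NNReal.coe_le_coe] at hwv
  set s₁ : ℝ := ((w : ℝ) - c) / (v - c)
  set s₂ : ℝ := ((d : ℝ) - w) / (d - v)
  have hs₁_pos : 0 < s₁ := div_pos (by linarith) (by linarith)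
  have hs₁_le : s₁ ≤ 1 := (div_le_one (by linarith)).2 (by linarith)
  have hs₂_ge : 1 ≤ s₂ := (one_le_div (by linarith)).2 (by linarith)
  have hs₁_mul : s₁ * (v - c) = w - c := div_mul_cancel₀ _ (by linarith)
  have hs₂_mul : s₂ * (d - v) = d - w := div_mul_cancel₀ _ (by linarith)
  -- The broken line through `(c, c)`, `(v, w)` and `(d, d)`, continued by the diagonal.
  let f : ℝ → ℝ := fun x => min x (max (w + (x - v) * s₁) (w + (x - v) * s₂))
  have hmono : StrictMono f :=
    fun x y hxy => min_lt_min hxy (max_lt_max (by nlinarith) (by nlinarith))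
  have hlow : ∀ x : ℝ, x ≤ c → f x = x :=
    fun x hx => min_eq_left (le_max_of_le_left (by nlinarith))
  have hhigh : ∀ x : ℝ, d ≤ x → f x = x :=
    fun x hx => min_eq_left (le_max_of_le_right (by nlinarith))
  have htop : Tendsto f atTop atTop :=
    tendsto_id.congr' ((eventually_ge_atTop (d : ℝ)).mono fun x hx => (hhigh x hx).symm)
  have hbot : Tendsto f atBot atBot :=
    tendsto_id.congr' ((eventually_le_atBot (c : ℝ)).mono fun x hx => (hlow x hx).symm)
  have hsurj : Function.Surjective f := Continuous.surjective (by fun_prop) htop hbot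
  obtain ⟨σ, hσ⟩ := exists_nnreal_orderIso hmono hsurj (hlow 0 c.2)
  refine ⟨σ, ?_, fun x hx => ?_, fun x hx => ?_⟩ <;> rw [← NNReal.coe_inj, hσ]
  · simpa [f] using hwv
  · exact hlow x hx
  · exact hhigh x hx

theorem exists_orderIso_bump {c d v w : ℝ≥0} (hv : v ∈ Set.Ioo c d) (hw : w ∈ Set.Ioo c d) :
    ∃ σ : ℝ≥0 ≃o ℝ≥0, σ v = w ∧ (∀ x ≤ c, σ x = x) ∧ ∀ x, d ≤ x → σ x = x := by
  rcases le_total w v with h | h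
  · exact exists_orderIso_bump_of_le hv.1 hv.2 hw.1 h
  · obtain ⟨σ, hσ, hlow, hhigh⟩ := exists_orderIso_bump_of_le hw.1 hw.2 hv.1 h
    exact ⟨σ.symm, by rw [← hσ, σ.symm_apply_apply],
      fun x hx => σ.symm_apply_eq.2 (hlow x hx).symm,
      fun x hx => σ.symm_apply_eq.2 (hhigh x hx).symm⟩

theorem exists_timeChange (h : ℝ≥0) (m : ℕ) {v w : ℕ → ℝ≥0}
    (hv : ∀ b : ℕ, v b ∈ Set.Ioo (b * h) ((b + 1) * h))
    (hw : ∀ b : ℕ, w b ∈ Set.Ioo (b * h) ((b + 1) * h)) :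
    ∃ τ : ℝ≥0 ≃o ℝ≥0, (∀ b < m, τ (v b) = w b) ∧ ∀ b : ℕ, τ (b * h) = b * h := by
  induction m with
  | zero => exact ⟨OrderIso.refl _, by simp, by simp⟩
  | succ m ih =>
    obtain ⟨τ, hτ, hτ_grid⟩ := ih
    have hτ_mem : τ (v m) ∈ Set.Ioo (m * h) ((m + 1) * h) := by
      rw [← hτ_grid m, ← Nat.cast_add_one, ← hτ_grid (m + 1)]
      exact ⟨τ.strictMono (hv m).1, τ.strictMono (by exact_mod_cast (hv m).2)⟩
    obtain ⟨σ, hσ, hlow, hhigh⟩ := exists_orderIso_bump hτ_mem (hw m)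
    refine ⟨τ.trans σ, fun b hb => ?_, fun b => ?_⟩
    · rw [OrderIso.trans_apply]
      rcases Nat.lt_succ_iff_lt_or_eq.1 hb with hbm | rfl
      · rw [hτ b hbm]
        refine hlow _ ((hw b).2.le.trans ?_)
        gcongr
        exact_mod_cast hbm
      · exact hσ
    · rw [OrderIso.trans_apply, hτ_grid]
      rcases le_or_gt b m with hb | hb
      · exact hlow _ (by gcongr)
      · refine hhigh _ ?_
        gcongr
        exact_mod_cast hb

theorem dist_timeChange_le (hh : 0 < h) {τ : ℝ≥0 ≃o ℝ≥0}
    (hτ : ∀ b : ℕ, τ (b * h) = b * h) (u : ℝ≥0) : dist (τ u) u ≤ h := by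
  rcases eq_zero_or_pos u with rfl | hu
  · simp [map_bot τ, ← bot_eq_zero']
  · obtain ⟨b, hbu, hub⟩ := exists_mem_timeCell hh hu
    have hbτ : b * h ≤ τ u := hτ b ▸ τ.monotone hbu.le
    have hτb : τ u ≤ (b + 1) * h := by
      have hgrid := hτ (b + 1)
      rw [Nat.cast_add_one] at hgrid
      exact hgrid ▸ τ.monotone hub
    rw [← NNReal.coe_le_coe] at hbτ hτb hub
    rw [← NNReal.coe_lt_coe] at hbu
    push_cast at hbτ hτb hbu hub
    rw [NNReal.dist_eq, abs_le]
    constructor <;> linarith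

end TimeCells

/-! ### Patterns -/

section Patterns

variable {ι κ F T : Type*} [TopologicalSpace T] {s : Set ι} {y : ι → F} {S : Set F}
  {A : κ → Set F}

/-- The pattern of the points `y i`, `i ∈ s`, in the region `S`: it is `none` if there is no point
in `S`, and `some l` if there is exactly one point in `S` and this point lies in `A l`. The points
have no pattern if there is more than one point in `S`, or one outside of all `A l`. -/
def HasPattern (s : Set ι) (y : ι → F) (S : Set F) (A : κ → Set F) : Option κ → Prop
  | none => ∀ i ∈ s, y i ∉ S
  | some l => ∃ i ∈ s, y i ∈ A l ∧ ∀ i' ∈ s, y i' ∈ S → i' = i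

theorem HasPattern.unique (hAS : ∀ l, A l ⊆ S) (hA : Pairwise (Function.onFun Disjoint A))
    {q q' : Option κ} (hq : HasPattern s y S A q) (hq' : HasPattern s y S A q') : q = q' := by
  match q, q', hq, hq' with
  | none, none, _, _ => rfl
  | none, some l, hq, ⟨i, hi, hil, _⟩ => exact absurd (hAS l hil) (hq i hi)
  | some l, none, ⟨i, hi, hil, _⟩, hq' => exact absurd (hAS l hil) (hq' i hi)
  | some l, some l', ⟨i, hi, hil, _⟩, ⟨i', _, hil', hunique⟩ =>
    obtain rfl := hunique i hi (hAS l hil)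
    exact congrArg some (hA.eq (Set.not_disjoint_iff.2 ⟨y i, hil, hil'⟩))

theorem HasPattern.eq_of_mem {q : Option κ} (hq : HasPattern s y S A q)
    {i i' : ι} (hi : i ∈ s) (hi' : i' ∈ s) (hiS : y i ∈ S) (hiS' : y i' ∈ S) : i = i' := by
  cases q with
  | none => exact absurd hiS (hq i hi)
  | some l =>
    obtain ⟨_, _, _, hunique⟩ := hq
    exact (hunique i hi hiS).trans (hunique i' hi' hiS').symm

theorem HasPattern.dist_elim_le [CompactSpace T] {q : Option κ} (hq : HasPattern s y S A q)
    {φ : F → CPlus T} {g : κ → CPlus T} {ε : ℝ≥0} (hA : ∀ l, ∀ p ∈ A l, dist (φ p) (g l) ≤ ε)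
    {i : ι} (hi : i ∈ s) (hiS : y i ∈ S) : dist (φ (y i)) (q.elim 0 g) ≤ ε := by
  cases q with
  | none => exact absurd hiS (hq i hi)
  | some l =>
    obtain ⟨_, _, hil, hunique⟩ := hq
    obtain rfl := hunique i hi hiS
    exact hA l _ hil

/-- The path of order statistics which has the function `g l` in the middle of each time cell `b`
with `q b = some l`. -/
def patternPath [CompactSpace T] {m : ℕ} (g : κ → CPlus T) (h : ℝ≥0) (r : ℕ)
    (q : Fin m → Option κ) : SkorokhodSpace (Fin r → CPlus T) :=
  orderPath (LocallyFinitelyLarge.of_finite fun b => ((q b).elim 0 g, timeMid h b)) r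

variable {x : ι → F × ℝ≥0} {m : ℕ} {h : ℝ≥0} {q : Fin m → Option κ}

theorem exists_timeChange_timeMid (hh : 0 < h)
    (hgrid : ∀ i, (x i).1 ∈ S → ∀ b : ℕ, (x i).2 ≠ b * h)
    (hq : ∀ b : Fin m, HasPattern {i | (x i).2 ∈ timeCell h b} (fun i => (x i).1) S A (q b)) :
    ∃ τ : ℝ≥0 ≃o ℝ≥0, (∀ b : ℕ, τ (b * h) = b * h) ∧
      ∀ (b : Fin m) i, (x i).1 ∈ S → (x i).2 ∈ timeCell h b → τ (x i).2 = timeMid h b := by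
  have hmark : ∀ b : ℕ, ∃ w ∈ Set.Ioo (b * h) ((b + 1) * h),
      b < m → ∀ i, (x i).1 ∈ S → (x i).2 ∈ timeCell h b → (x i).2 = w := by
    intro b
    by_cases hb : ∃ i, b < m ∧ (x i).1 ∈ S ∧ (x i).2 ∈ timeCell h b
    · obtain ⟨i, hbm, hiS, hib⟩ := hb
      refine ⟨(x i).2, ⟨hib.1, hib.2.lt_of_ne (by exact_mod_cast hgrid i hiS (b + 1))⟩, ?_⟩
      intro _ i' hiS' hib'
      exact congrArg (fun i => (x i).2) ((hq ⟨b, hbm⟩).eq_of_mem hib' hib hiS' hiS)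
    · push Not at hb
      exact ⟨timeMid h b, timeMid_mem_Ioo hh b, fun hbm i hiS hib => absurd hib (hb i hbm hiS)⟩
  choose w hw hw_eq using hmark
  obtain ⟨τ, hτ, hτ_grid⟩ := exists_timeChange h m hw (timeMid_mem_Ioo hh)
  refine ⟨τ, hτ_grid, fun b i hiS hib => ?_⟩
  rw [hw_eq b b.2 i hiS hib, hτ b b.2]

theorem orderPath_patternPath_mem_entourage [CompactSpace T] {φ : F → CPlus T} {g : κ → CPlus T}
    {ε a : ℝ≥0} (hx : LocallyFinitelyLarge fun i => (φ (x i).1, (x i).2))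
    (hS : ∀ p, (∃ t, ε < φ p t) → p ∈ S) (hAS : ∀ l, A l ⊆ S)
    (hA : ∀ l, ∀ p ∈ A l, dist (φ p) (g l) ≤ ε) (hh : 0 < h) (hhε : h ≤ ε) (ha : a ≤ m * h)
    (hgrid : ∀ i, (x i).1 ∈ S → ∀ b : ℕ, (x i).2 ≠ b * h)
    (hq : ∀ b : Fin m, HasPattern {i | (x i).2 ∈ timeCell h b} (fun i => (x i).1) S A (q b))
    (r : ℕ) :
    (orderPath hx r, patternPath g h r q) ∈
      SkorokhodSpace.entourage (Fin r → CPlus T) a ε := by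
  obtain ⟨τ, hτ_grid, hτ⟩ := exists_timeChange_timeMid hh hgrid hq
  refine ⟨τ, fun u hu => ⟨(dist_timeChange_le hh hτ_grid u).trans (by exact_mod_cast hhε), ?_⟩⟩
  let R : ι → Fin m → Prop := fun i b => (x i).1 ∈ S ∧ (x i).2 ∈ timeCell h b
  have hR : Relator.BiUnique R :=
    ⟨fun i i' b hi hi' => (hq b).eq_of_mem hi.2 hi'.2 hi.1 hi'.1,
      fun i b b' hb hb' => Fin.ext (timeCell_unique hb.2 hb'.2)⟩
  have hleft : ∀ i ∈ {i | (x i).2 ≤ u}, (∃ t, ε < φ (x i).1 t) →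
      ∃ b ∈ {b : Fin m | timeMid h b ≤ τ u}, R i b ∧ dist (φ (x i).1) ((q b).elim 0 g) ≤ ε := by
    intro i hiu hi
    have hiS := hS _ hi
    have hpos : 0 < (x i).2 := pos_iff_ne_zero.2 (by simpa using hgrid i hiS 0)
    obtain ⟨b, hib⟩ := exists_mem_timeCell hh hpos
    have hbm : b + 1 ≤ m := le_of_mem_timeCell hib ((Set.mem_ofPred.1 hiu).trans (hu.trans ha))
    have hmid := hτ ⟨b, hbm⟩ i hiS hib
    exact ⟨⟨b, hbm⟩, hmid.ge.trans (τ.monotone hiu), ⟨hiS, hib⟩,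
      (hq ⟨b, hbm⟩).dist_elim_le hA hib hiS⟩
  have hright : ∀ b ∈ {b : Fin m | timeMid h b ≤ τ u}, (∃ t, ε < (q b).elim 0 g t) →
      ∃ i ∈ {i | (x i).2 ≤ u}, R i b ∧ dist (φ (x i).1) ((q b).elim 0 g) ≤ ε := by
    intro b hbu hb
    have hpat := hq b
    cases hqb : q b with
    | none => simp [hqb] at hb
    | some l =>
      rw [hqb] at hpat
      obtain ⟨i, hib, hil, _⟩ := hpat
      have hiS := hAS l hil
      have hmid := hτ b i hiS hib
      exact ⟨i, τ.le_iff_le.1 (hmid.trans_le hbu), ⟨hiS, hib⟩, hA l _ hil⟩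
  exact (dist_pi_le_iff ε.2).2 fun j =>
    dist_orderStatFun_le (hx u) (LocallyFinitelyLarge.of_finite _ (τ u)) hR hleft hright j

end Patterns

/-! ### The uniformity of the Skorokhod space -/

theorem SkorokhodSpace.hasBasis_uniformity (E : Type*) [PseudoMetricSpace E] :
    (uniformity (SkorokhodSpace E)).HasBasis (fun p : ℝ≥0 × ℝ≥0 => 0 < p.2)
      (fun p => entourage E p.1 p.2) := by
  refine (entourageBasis E).hasBasis.to_hasBasis ?_ ?_
  · rintro _ ⟨a, ε, hε, rfl⟩
    exact ⟨(a, ε), hε, subset_rfl⟩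
  · rintro ⟨a, ε⟩ hε
    exact ⟨_, ⟨a, ε, hε, rfl⟩, subset_rfl⟩

instance SkorokhodSpace.isCountablyGenerated_uniformity (E : Type*) [PseudoMetricSpace E] :
    (uniformity (SkorokhodSpace E)).IsCountablyGenerated := by
  have hbasis : (uniformity (SkorokhodSpace E)).HasBasis (fun _ : ℕ => True)
      (fun k => entourage E (k : ℝ≥0) (1 / ((k : ℝ≥0) + 1))) := by
    refine (SkorokhodSpace.hasBasis_uniformity E).to_hasBasis ?_ ?_
    · rintro ⟨a, ε⟩ hε
      obtain ⟨k₁, hk₁⟩ := exists_nat_ge a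
      obtain ⟨k₂, hk₂⟩ := exists_nat_one_div_lt (show 0 < ε from hε)
      refine ⟨max k₁ k₂, trivial, entourage_mono (hk₁.trans ?_) (le_trans ?_ hk₂.le)⟩
      · exact_mod_cast le_max_left _ _
      · gcongr
        exact_mod_cast le_max_right _ _
    · intro k _
      exact ⟨(k, 1 / ((k : ℝ≥0) + 1)), by positivity, subset_rfl⟩
  exact hbasis.isCountablyGenerated

/-! ### The path of a triangular array -/

section ArrayPath

variable {T : Type*} [TopologicalSpace T]

/-- The functions of row `n` of an array, with the `i`-th function (counted from `0`) occurring at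
time `(i + 1) / n`. In row `0` this time is the junk value `0`, and the functions are discarded. -/
def arrayPoint (n : ℕ) (x : ℕ → CPlus T) (i : ℕ) : CPlus T × ℝ≥0 :=
  (if n = 0 then 0 else x i, (i + 1) / n)

theorem arrayTime_le_iff {n : ℕ} (hn : n ≠ 0) (i : ℕ) (u : ℝ≥0) :
    ((i : ℝ≥0) + 1) / n ≤ u ↔ i < ⌊n * u⌋₊ := by
  rw [div_le_iff₀ (by positivity), mul_comm, ← Nat.succ_le_iff, Nat.le_floor_iff zero_le,
    Nat.cast_succ]

theorem locallyFinitelyLarge_arrayPoint (n : ℕ) (x : ℕ → CPlus T) :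
    LocallyFinitelyLarge (arrayPoint n x) := by
  intro u ε _
  rcases eq_or_ne n 0 with rfl | hn
  · simp [arrayPoint]
  · exact (Set.finite_lt_nat ⌊n * u⌋₊).subset fun i hi => (arrayTime_le_iff hn i u).1 hi.1

variable [CompactSpace T]

/-- The path of the first `r` order statistics of `x 0, …, x (⌊nu⌋ - 1)`. -/
def arrayPath (n r : ℕ) (x : ℕ → CPlus T) : SkorokhodSpace (Fin r → CPlus T) :=
  orderPath (locallyFinitelyLarge_arrayPoint n x) r

theorem arrayPath_apply (n : ℕ) {r : ℕ} (x : ℕ → CPlus T) (u : ℝ≥0) (j : Fin r) (t : T) :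
    arrayPath n r x u j t =
      nthLargest ((Multiset.range ⌊(n : ℝ≥0) * u⌋₊).map fun i => x i t) j := by
  rw [arrayPath, orderPath_apply, ← Finset.range_val, nthLargest_map_val]
  rcases eq_or_ne n 0 with rfl | hn
  · refine sSup_eq_sSup_of_forall_pos fun y hy => ?_
    simp [arrayPoint, hy.ne']
  · simp [arrayPoint, arrayTime_le_iff hn, hn, orderStat]

theorem continuous_arrayPath (n r : ℕ) : Continuous (arrayPath (T := T) n r) := by
  refine continuous_iff_continuousAt.2 fun x =>
    (nhds_basis_uniformity' (SkorokhodSpace.hasBasis_uniformity _)).tendsto_right_iff.2 ?_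
  rintro ⟨a, ε⟩ hε
  have hnear : ∀ᶠ y in 𝓝 x, ∀ i < ⌊n * a⌋₊, dist (y i) (x i) ≤ ε :=
    (eventually_all_finite (Set.finite_lt_nat _)).2 fun i _ =>
      Metric.nhds_basis_closedBall.tendsto_right_iff.1
        ((continuous_apply i).tendsto x) ε (by exact_mod_cast hε)
  filter_upwards [hnear] with y hy
  refine ⟨OrderIso.refl _, fun u hu => ⟨by simp, (dist_pi_le_iff ε.2).2 fun j => ?_⟩⟩
  have hdist : ∀ i, (arrayPoint n x i).2 ≤ u →
      dist (arrayPoint n x i).1 (arrayPoint n y i).1 ≤ ε := by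
    intro i hi
    rcases eq_or_ne n 0 with rfl | hn
    · simp [arrayPoint]
    · simpa [arrayPoint, hn, dist_comm] using hy i ((arrayTime_le_iff hn i a).1 (hi.trans hu))
  exact dist_orderStatFun_le (R := Eq) (locallyFinitelyLarge_arrayPoint n x u)
    (locallyFinitelyLarge_arrayPoint n y u) biUnique_eq
    (fun i hi _ => ⟨i, hi, rfl, hdist i hi⟩) (fun i hi _ => ⟨i, hi, rfl, hdist i hi⟩) j

end ArrayPath

/-! ### The path of a point measure -/

section PointMeasure

theorem CPlus.apply_le_supNorm {T : Type*} [TopologicalSpace T] [CompactSpace T] (x : CPlus T)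
    (t : T) : x t ≤ x.supNorm :=
  le_ciSup x.bddAbove_range t

variable {T : Type*} [TopologicalSpace T]

/-- The function `r s` represented by the point `(r, s)`, and `0` if `r = ∞`. -/
def PolarSpace.toCPlus (p : PolarSpace T) : CPlus T := p.radius.toNNReal • p.angle

theorem PolarSpace.toCPlus_apply (p : PolarSpace T) (t : T) :
    p.toCPlus t = p.radius.toNNReal * p.angle t := rfl

theorem sum_dirac_apply {ι E : Type*} [Countable ι] [MeasurableSpace E]
    [MeasurableSingletonClass E] (x : ι → E) (S : Set E) :
    (Measure.sum fun i => Measure.dirac (x i)) S = ({i | x i ∈ S}.encard : ℝ≥0∞) := by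
  have hdirac : ∀ i, Measure.dirac (x i) S = {i | x i ∈ S}.indicator 1 i := fun i =>
    (Measure.dirac_apply _ _).trans rfl
  simp_rw [Measure.sum_apply_of_countable, hdirac, ← tsum_subtype, Pi.one_apply, ENNReal.tsum_one,
    Set.encard]

variable [CompactSpace T]

theorem PolarSpace.angle_le_one (p : PolarSpace T) (t : T) : p.angle t ≤ 1 :=
  p.supNorm_angle ▸ p.angle.apply_le_supNorm t

theorem PolarSpace.toCPlus_le_radius (p : PolarSpace T) (t : T) :
    (p.toCPlus t : ℝ≥0∞) ≤ p.radius := by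
  refine le_trans (ENNReal.coe_le_coe.2 ?_) ENNReal.coe_toNNReal_le_self
  exact mul_le_of_le_one_right zero_le (p.angle_le_one t)

theorem PolarSpace.isBounded_le_radius {c : ℝ≥0∞} (hc : 0 < c) :
    Bornology.IsBounded {p : PolarSpace T | c ≤ p.radius} := by
  refine Metric.isBounded_iff.2 ⟨(c⁻¹).toReal + 1, fun p hp q hq => add_le_add ?_ ?_⟩
  · have hinv : ∀ p : PolarSpace T, c ≤ p.radius → (p.radius⁻¹).toReal ∈ Set.Icc 0 (c⁻¹).toReal :=
      fun p hp => ⟨ENNReal.toReal_nonneg,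
        ENNReal.toReal_mono (ENNReal.inv_ne_top.2 hc.ne') (ENNReal.inv_le_inv.2 hp)⟩
    exact abs_sub_le_of_nonneg_of_le (hinv p hp).1 (hinv p hp).2 (hinv q hq).1 (hinv q hq).2
  · refine (ContinuousMap.dist_le zero_le_one).2 fun t => ?_
    rw [NNReal.dist_eq]
    exact abs_sub_le_of_nonneg_of_le (p.angle t).2 (p.angle_le_one t) (q.angle t).2
      (q.angle_le_one t)

variable {ι : Type*} {x : ι → PolarSpace T × ℝ≥0}

theorem locallyFinitelyLarge_of_finite_preimage
    (hx : ∀ B : Set (PolarSpace T × ℝ≥0), Bornology.IsBounded B → {i | x i ∈ B}.Finite) :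
    LocallyFinitelyLarge fun i => ((x i).1.toCPlus, (x i).2) := by
  intro u ε hε
  have hbounded : Bornology.IsBounded ({p : PolarSpace T | (ε : ℝ≥0∞) ≤ p.radius} ×ˢ Set.Iic u) :=
    (PolarSpace.isBounded_le_radius (by exact_mod_cast hε)).prod
      (Set.Icc_bot (a := u) ▸ Metric.isBounded_Icc ⊥ u)
  refine (hx _ hbounded).subset fun i ⟨hi, t, ht⟩ => ⟨?_, hi⟩
  exact (ENNReal.coe_le_coe.2 ht.le).trans ((x i).1.toCPlus_le_radius t)

theorem spaceTimeOrderStat_sum_dirac [Countable ι] (x : ι → PolarSpace T × ℝ≥0) (j : ℕ) (u : ℝ≥0)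
    (t : T) : spaceTimeOrderStat (Measure.sum fun i => Measure.dirac (x i)) j u t =
      orderStat {i | (x i).2 ≤ u} (fun i => (x i).1.toCPlus t) j := by
  refine sSup_eq_sSup_of_forall_pos fun y hy => ?_
  have hset : {i | x i ∈ exceedanceSet u t y} =
      {i | i ∈ {i | (x i).2 ≤ u} ∧ y ≤ (x i).1.toCPlus t} := by
    ext i
    simp only [exceedanceSet, Set.mem_ofPred_eq, PolarSpace.toCPlus_apply]
    rcases eq_or_ne (x i).1.radius ∞ with hr | hr
    · simp [hr, hy.ne']
    · rw [← ENNReal.coe_le_coe (r := y), ENNReal.coe_mul, ENNReal.coe_toNNReal hr]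
      tauto
  rw [Set.mem_ofPred_eq, Set.mem_ofPred_eq, sum_dirac_apply, hset]
  norm_cast

end PointMeasure

/-! ### Convergence in distribution through finite discretisations -/

section Discretisation

/-- On each of the disjoint events `A k`, the random element `Y` is `V`-close to the constant
`y k`. Nothing is required outside of these events. -/
structure IsDiscretisation {Ω D κ : Type*} [MeasurableSpace Ω] (P : Measure Ω) (Y : Ω → D)
    (V : Set (D × D)) (y : κ → D) (A : κ → Set Ω) : Prop where
  measurableSet : ∀ k, MeasurableSet (A k)
  pairwise_disjoint : Pairwise (Function.onFun Disjoint A)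
  ae_mem : ∀ k, ∀ᵐ ω ∂P, ω ∈ A k → (Y ω, y k) ∈ V

/-- The random elements `Y n` and `Y'` can simultaneously be discretised, up to the entourage `V`
and an event of probability at most `η` in the limit, by finitely many values that are taken with
convergent probabilities. -/
def HasFiniteApproximation {D : Type*} {Ω : ℕ → Type*} [∀ n, MeasurableSpace (Ω n)]
    (P : (n : ℕ) → Measure (Ω n)) (Y : (n : ℕ) → Ω n → D) {Ω' : Type*} [MeasurableSpace Ω']
    (P' : Measure Ω') (Y' : Ω' → D) (V : Set (D × D)) (η : ℝ) : Prop :=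
  ∃ (κ : Type) (_ : Fintype κ) (y : κ → D) (A : (n : ℕ) → κ → Set (Ω n)) (A' : κ → Set Ω'),
    (∀ᶠ n in atTop, IsDiscretisation (P n) (Y n) V y (A n)) ∧ IsDiscretisation P' Y' V y A' ∧
    (∀ k, Tendsto (fun n => (P n).real (A n k)) atTop (𝓝 (P'.real (A' k)))) ∧
    P'.real (⋃ k, A' k)ᶜ ≤ η

namespace IsDiscretisation

variable {Ω D κ : Type*} [MeasurableSpace Ω] {P : Measure Ω} {Y : Ω → D} {V : Set (D × D)}
  {y : κ → D} {A : κ → Set Ω}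

theorem exists_measurable [Countable κ] [Nonempty D] [MeasurableSpace D]
    (h : IsDiscretisation P Y V y A) : ∃ Z : Ω → D, Measurable Z ∧ ∀ k, ∀ ω ∈ A k, Z ω = y k := by
  rcases isEmpty_or_nonempty κ with _ | _
  · exact ⟨fun _ => Classical.arbitrary D, measurable_const, isEmptyElim⟩
  obtain ⟨Z, hZ, hZA⟩ := exists_measurable_piecewise A h.measurableSet (fun k _ => y k)
    (fun _ => measurable_const) (fun k k' hkk' ω hω =>
      absurd hω.2 (Set.disjoint_left.1 (h.pairwise_disjoint hkk') hω.1))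
  exact ⟨Z, hZ, fun k ω hω => hZA k hω⟩

variable [Fintype κ] [IsProbabilityMeasure P]

theorem measureReal_compl_iUnion (h : IsDiscretisation P Y V y A) :
    P.real (⋃ k, A k)ᶜ = 1 - ∑ k, P.real (A k) := by
  rw [probReal_compl_eq_one_sub (MeasurableSet.iUnion h.measurableSet),
    measureReal_iUnion_fintype h.pairwise_disjoint h.measurableSet]

theorem abs_integral_sub_sum_le (h : IsDiscretisation P Y V y A) {F : D → ℝ}
    (hF : AEStronglyMeasurable (fun ω => F (Y ω)) P) {C ε : ℝ} (hε : 0 ≤ ε)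
    (hC : ∀ z, |F z| ≤ C) (hV : ∀ z z', (z, z') ∈ V → |F z - F z'| ≤ ε) :
    |∫ ω, F (Y ω) ∂P - ∑ k, P.real (A k) * F (y k)| ≤ ε + C * P.real (⋃ k, A k)ᶜ := by
  have hint : Integrable (fun ω => F (Y ω)) P :=
    Integrable.of_bound hF C (ae_of_all _ fun _ => hC _)
  have hsplit : ∫ ω, F (Y ω) ∂P - ∑ k, P.real (A k) * F (y k) =
      ∑ k, ∫ ω in A k, (F (Y ω) - F (y k)) ∂P + ∫ ω in (⋃ k, A k)ᶜ, F (Y ω) ∂P := by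
    rw [← integral_add_compl (MeasurableSet.iUnion h.measurableSet) hint,
      integral_iUnion_fintype h.measurableSet h.pairwise_disjoint fun k => hint.integrableOn,
      add_sub_right_comm, ← Finset.sum_sub_distrib]
    congr 1
    refine Finset.sum_congr rfl fun k _ => ?_
    rw [integral_sub hint.integrableOn (integrable_const _), setIntegral_const, smul_eq_mul]
  have hcell : ∀ k, |∫ ω in A k, (F (Y ω) - F (y k)) ∂P| ≤ ε * P.real (A k) := fun k =>
    norm_setIntegral_le_of_norm_le_const_ae' (f := fun ω => F (Y ω) - F (y k))
      (measure_lt_top _ _) ((h.ae_mem k).mono fun ω hω hωk => hV _ _ (hω hωk))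
  have hcells : |∑ k, ∫ ω in A k, (F (Y ω) - F (y k)) ∂P| ≤ ε := by
    calc |∑ k, ∫ ω in A k, (F (Y ω) - F (y k)) ∂P|
        ≤ ∑ k, |∫ ω in A k, (F (Y ω) - F (y k)) ∂P| := Finset.abs_sum_le_sum_abs _ _
      _ ≤ ∑ k, ε * P.real (A k) := Finset.sum_le_sum fun k _ => hcell k
      _ = ε * P.real (⋃ k, A k) := by
        rw [← Finset.mul_sum, measureReal_iUnion_fintype h.pairwise_disjoint h.measurableSet]
      _ ≤ ε := mul_le_of_le_one_right hε measureReal_le_one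
  have hrest : |∫ ω in (⋃ k, A k)ᶜ, F (Y ω) ∂P| ≤ C * P.real (⋃ k, A k)ᶜ :=
    norm_setIntegral_le_of_norm_le_const (f := fun ω => F (Y ω)) (measure_lt_top _ _)
      fun _ _ => hC _
  rw [hsplit]
  exact (abs_add_le _ _).trans (add_le_add hcells hrest)

end IsDiscretisation

variable {D : Type*} [UniformSpace D] [MeasurableSpace D] [BorelSpace D]

theorem aemeasurable_of_forall_isDiscretisation [(uniformity D).IsCountablyGenerated] {Ω : Type*}
    [MeasurableSpace Ω] {P : Measure Ω} [IsProbabilityMeasure P] {Y : Ω → D}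
    (h : ∀ V ∈ uniformity D, ∀ η > 0, ∃ (κ : Type) (_ : Countable κ) (y : κ → D) (A : κ → Set Ω),
      IsDiscretisation P Y V y A ∧ P.real (⋃ k, A k)ᶜ ≤ η) :
    AEMeasurable Y P := by
  obtain ⟨V, hV⟩ := (uniformity D).exists_antitone_basis
  choose κ _ y A hA hbad using fun k : ℕ =>
    h (V k) (hV.mem k) ((1 / 2 : ℝ) ^ k) (by positivity)
  have : Nonempty D := P.nonempty_of_neZero.map Y
  choose Z hZ hZA using fun k => (hA k).exists_measurable
  refine aemeasurable_of_tendsto_metrizable_ae atTop (fun k => (hZ k).aemeasurable) ?_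
  have hsummable : ∑' k, P (⋃ i, A k i)ᶜ ≠ ∞ := by
    have hle : ∀ k, P (⋃ i, A k i)ᶜ ≤ ENNReal.ofReal ((1 / 2 : ℝ) ^ k) := fun k =>
      ENNReal.le_ofReal_iff_toReal_le (measure_ne_top _ _) (by positivity) |>.2 (hbad k)
    refine ne_top_of_le_ne_top ?_ (ENNReal.tsum_le_tsum hle)
    rw [← ENNReal.ofReal_tsum_of_nonneg (fun k => by positivity) summable_geometric_two]
    exact ENNReal.ofReal_ne_top
  filter_upwards [ae_eventually_notMem hsummable,
    ae_all_iff.2 fun k => ae_all_iff.2 fun i => (hA k).ae_mem i] with ω hω hmem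
  refine (nhds_basis_uniformity' hV.toHasBasis).tendsto_right_iff.2 fun k _ => ?_
  filter_upwards [hω, eventually_ge_atTop k] with l hl hkl
  obtain ⟨i, hi⟩ := Set.mem_iUnion.1 (Set.notMem_compl_iff.1 hl)
  rw [hZA l i ω hi]
  exact hV.antitone hkl (hmem l i hi)

variable {Ω : ℕ → Type*} [∀ n, MeasurableSpace (Ω n)] {P : (n : ℕ) → Measure (Ω n)}
  [∀ n, IsProbabilityMeasure (P n)] {Y : (n : ℕ) → Ω n → D} {Ω' : Type*} [MeasurableSpace Ω']
  {P' : Measure Ω'} [IsProbabilityMeasure P'] {Y' : Ω' → D}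

theorem tendsto_integral_of_hasFiniteApproximation (hY : ∀ n, AEMeasurable (Y n) (P n))
    (hY' : AEMeasurable Y' P')
    (h : ∀ V ∈ uniformity D, ∀ η > 0, HasFiniteApproximation P Y P' Y' V η)
    {F : D → ℝ} (hF : UniformContinuous F) {C : ℝ} (hC : ∀ z, |F z| ≤ C) :
    Tendsto (fun n => ∫ ω, F (Y n ω) ∂P n) atTop (𝓝 (∫ ω, F (Y' ω) ∂P')) := by
  obtain ⟨ω₀⟩ : Nonempty Ω' := P'.nonempty_of_neZero
  have hC₀ : 0 ≤ C := (abs_nonneg _).trans (hC (Y' ω₀))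
  refine Metric.tendsto_nhds.2 fun δ hδ => ?_
  obtain ⟨κ, _, y, A, A', hA, hA', hlim, hbad⟩ :=
    h _ (hF (Metric.dist_mem_uniformity (show 0 < δ / 8 by positivity))) (δ / (8 * (C + 1)))
      (by positivity)
  have hV : ∀ z z', dist (F z) (F z') < δ / 8 → |F z - F z'| ≤ δ / 8 := fun _ _ hz => hz.le
  have hbad' : C * P'.real (⋃ k, A' k)ᶜ ≤ δ / 8 := by
    calc C * P'.real (⋃ k, A' k)ᶜ ≤ (C + 1) * (δ / (8 * (C + 1))) := by gcongr; linarith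
      _ = δ / 8 := by field_simp
  have hbad_lim : Tendsto (fun n => C * (1 - ∑ k, (P n).real (A n k))) atTop
      (𝓝 (C * P'.real (⋃ k, A' k)ᶜ)) := by
    rw [hA'.measureReal_compl_iUnion]
    exact (tendsto_const_nhds.sub (tendsto_finsetSum _ fun k _ => hlim k)).const_mul C
  have hsum_lim : Tendsto (fun n => ∑ k, (P n).real (A n k) * F (y k)) atTop
      (𝓝 (∑ k, P'.real (A' k) * F (y k))) :=
    tendsto_finsetSum _ fun k _ => (hlim k).mul_const _
  have hF' := hA'.abs_integral_sub_sum_le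
    (hF.continuous.measurable.comp_aemeasurable hY').aestronglyMeasurable (by positivity) hC hV
  filter_upwards [hA, hbad_lim.eventually_lt_const (show _ < δ / 4 by linarith),
    Metric.tendsto_nhds.1 hsum_lim (δ / 8) (by positivity)] with n hAn hbad_n hsum_n
  have hFn := hAn.abs_integral_sub_sum_le
    (hF.continuous.measurable.comp_aemeasurable (hY n)).aestronglyMeasurable (by positivity) hC hV
  rw [hAn.measureReal_compl_iUnion] at hFn
  rw [Real.dist_eq, abs_lt] at hsum_n ⊢
  rw [abs_le] at hFn hF'
  constructor <;> linarith

theorem tendstoInDistribution_of_hasFiniteApproximation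
    [(uniformity D).IsCountablyGenerated] (hY : ∀ n, AEMeasurable (Y n) (P n))
    (h : ∀ V ∈ uniformity D, ∀ η > 0, HasFiniteApproximation P Y P' Y' V η) :
    TendstoInDistribution Y atTop Y' P P' := by
  have hY' : AEMeasurable Y' P' := aemeasurable_of_forall_isDiscretisation fun V hV η hη =>
    let ⟨κ, _, y, _, A', _, hA', _, hbad⟩ := h V hV η hη
    ⟨κ, inferInstance, y, A', hA', hbad⟩
  refine ⟨hY, hY', ?_⟩
  let _ : PseudoMetricSpace D := UniformSpace.pseudoMetricSpace D
  refine tendsto_iff_forall_lipschitz_integral_tendsto.2 ?_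
  rintro F ⟨C, hC⟩ ⟨L, hL⟩
  have hF : UniformContinuous F := hL.uniformContinuous
  obtain ⟨ω₀⟩ : Nonempty Ω' := P'.nonempty_of_neZero
  have hbound : ∀ z, |F z| ≤ C + |F (Y' ω₀)| := fun z =>
    calc |F z| ≤ |F z - F (Y' ω₀)| + |F (Y' ω₀)| := by
          simpa using abs_add_le (F z - F (Y' ω₀)) (F (Y' ω₀))
      _ ≤ C + |F (Y' ω₀)| := add_le_add_left (hC z (Y' ω₀)) _
  simpa [integral_map (hY _) hF.continuous.aestronglyMeasurable,
    integral_map hY' hF.continuous.aestronglyMeasurable] using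
    tendsto_integral_of_hasFiniteApproximation hY hY' h hF hbound

end Discretisation

/-! ### Sharp weak convergence and continuity sets -/

section SharpConvergence

variable {E : Type*}

theorem tendsto_finiteMeasure_apply_of_null_frontier [TopologicalSpace E] [MeasurableSpace E]
    [HasOuterApproxClosed E] [OpensMeasurableSpace E] {ι : Type*} {l : Filter ι}
    {μs : ι → FiniteMeasure E} {μ : FiniteMeasure E} (h : Tendsto μs l (𝓝 μ)) {S : Set E}
    (hS : μ (frontier S) = 0) : Tendsto (fun i => μs i S) l (𝓝 (μ S)) := by
  have hmass := h.mass
  rcases eq_or_ne μ 0 with rfl | hμ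
  · exact tendsto_of_tendsto_of_tendsto_of_le_of_le tendsto_const_nhds hmass
      (fun i => zero_le) fun i => (μs i).apply_le_mass S
  · have : Nonempty E := by
      by_contra hE
      have := not_nonempty_iff.1 hE
      exact hμ (Subtype.ext (Subsingleton.elim _ _))
    have hnormalize := FiniteMeasure.tendsto_normalize_of_tendsto h hμ
    have hfrontier : μ.normalize (frontier S) = 0 := by
      rw [FiniteMeasure.normalize_eq_of_nonzero _ hμ, hS, mul_zero]
    have := ProbabilityMeasure.tendsto_measure_of_null_frontier_of_tendsto hnormalize hfrontier
    simpa only [← FiniteMeasure.self_eq_mass_mul_normalize] using hmass.mul this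

variable [PseudoMetricSpace E] [MeasurableSpace E] [BorelSpace E]

theorem IsBoundedlyFinite.lintegral_ne_top {μ : Measure E} (hμ : IsBoundedlyFinite μ)
    (φ : E →ᵇ ℝ≥0) (hφ : Bornology.IsBounded (Function.support φ)) : ∫⁻ x, φ x ∂μ ≠ ∞ := by
  have hm : MeasurableSet (Function.support φ) := measurableSet_support φ.continuous.measurable
  have hsupp : Function.support (fun x => (φ x : ℝ≥0∞)) ⊆ Function.support φ := fun x hx => by
    simpa using hx
  rw [← setLIntegral_eq_of_support_subset hsupp]
  have : Fact (μ (Function.support φ) < ∞) := ⟨hμ _ hφ hm⟩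
  exact (BoundedContinuousFunction.lintegral_lt_top_of_nnreal _ φ).ne

/-- The finite measure with density `φ`, a bounded continuous function with bounded support, with
respect to a boundedly finite measure. -/
def IsBoundedlyFinite.withDensity {μ : Measure E} (hμ : IsBoundedlyFinite μ) (φ : E →ᵇ ℝ≥0)
    (hφ : Bornology.IsBounded (Function.support φ)) : FiniteMeasure E :=
  ⟨μ.withDensity fun x => φ x, isFiniteMeasure_withDensity (hμ.lintegral_ne_top φ hφ)⟩

theorem IsBoundedlyFinite.toMeasure_withDensity {μ : Measure E} (hμ : IsBoundedlyFinite μ)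
    (φ : E →ᵇ ℝ≥0) (hφ : Bornology.IsBounded (Function.support φ)) :
    (hμ.withDensity φ hφ : Measure E) = μ.withDensity fun x => φ x :=
  rfl

variable {μs : ℕ → Measure E} {μ : Measure E}

theorem TendstoSharpWeakly.tendsto_withDensity (h : TendstoSharpWeakly μs μ)
    (hμs : ∀ n, IsBoundedlyFinite (μs n)) (hμ : IsBoundedlyFinite μ) (φ : E →ᵇ ℝ≥0)
    (hφ : Bornology.IsBounded (Function.support φ)) :
    Tendsto (fun n => (hμs n).withDensity φ hφ) atTop (𝓝 (hμ.withDensity φ hφ)) := by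
  rw [FiniteMeasure.tendsto_iff_forall_integral_tendsto]
  intro f
  let φf : E →ᵇ ℝ := φ.comp _ NNReal.isometry_coe.lipschitz * f
  have hφf : Bornology.IsBounded (Function.support φf) :=
    hφ.subset fun x hx hφx => hx (by simp [φf, hφx])
  simp only [IsBoundedlyFinite.toMeasure_withDensity,
    integral_withDensity_eq_integral_smul φ.continuous.measurable]
  exact h φf hφf

theorem TendstoSharpWeakly.tendsto_measureReal (h : TendstoSharpWeakly μs μ)
    (hμs : ∀ n, IsBoundedlyFinite (μs n)) (hμ : IsBoundedlyFinite μ) {S : Set E}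
    (hSb : Bornology.IsBounded S) (hS : MeasurableSet S) (hfr : μ (frontier S) = 0) :
    Tendsto (fun n => (μs n).real S) atTop (𝓝 (μ.real S)) := by
  let φ : E →ᵇ ℝ≥0 := thickenedIndicator one_pos S
  have hφ : Bornology.IsBounded (Function.support φ) := hSb.thickening.subset fun x hx =>
    by_contra fun hxS => hx (thickenedIndicator_zero one_pos S hxS)
  have hdensity (ρ : Measure E) (hρ : IsBoundedlyFinite ρ) :
      (hρ.withDensity φ hφ : Measure E) S = ρ S := by
    rw [hρ.toMeasure_withDensity, withDensity_apply _ hS, setLIntegral_congr_fun (g := 1) hS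
      fun x hx => by simp [φ, thickenedIndicator_one one_pos S hx]]
    simp
  have hfr' : hμ.withDensity φ hφ (frontier S) = 0 := by
    rw [FiniteMeasure.null_iff_toMeasure_null, hμ.toMeasure_withDensity]
    exact withDensity_absolutelyContinuous μ _ hfr
  have hlim := tendsto_finiteMeasure_apply_of_null_frontier (h.tendsto_withDensity hμs hμ φ hφ) hfr'
  simpa only [FiniteMeasure.coeFn_def, hdensity, measureReal_def, ENNReal.toReal] using
    NNReal.tendsto_coe.2 hlim

end SharpConvergence

/-! ### The topology of the polar decomposition -/

section Polar

variable {T : Type*} [TopologicalSpace T]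

theorem PolarSpace.toReal_inv_radius_ne_zero {p : PolarSpace T} (hp : p.radius ≠ ∞) :
    (p.radius⁻¹).toReal ≠ 0 :=
  ENNReal.toReal_ne_zero.2 ⟨ENNReal.inv_ne_zero.2 hp, ENNReal.inv_ne_top.2 p.radius_pos.ne'⟩

theorem PolarSpace.toCPlus_eq_inv_smul (p : PolarSpace T) :
    p.toCPlus = ((p.radius⁻¹).toReal⁻¹).toNNReal • p.angle := by
  rw [← ENNReal.toReal_inv, inv_inv, ENNReal.toNNReal_toReal_eq, PolarSpace.toCPlus]

theorem measurableEmbedding_subtype_ne_zero :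
    MeasurableEmbedding (Subtype.val : {x : CPlus T // x ≠ 0} → CPlus T) :=
  MeasurableEmbedding.subtype_coe isOpen_ne.measurableSet

variable [CompactSpace T]

/-- The map `(r, s) ↦ (1 / r, s)` from `(0, ∞] × S` to `ℝ × C⁺`, which induces the topology. -/
def PolarSpace.embed (p : PolarSpace T) : ℝ × CPlus T := ((p.radius⁻¹).toReal, p.angle)

theorem PolarSpace.isInducing_embed :
    IsInducing (PolarSpace.embed : PolarSpace T → ℝ × CPlus T) := by
  have hdist : ∀ p q : PolarSpace T,
      dist p q = dist p.embed.1 q.embed.1 + dist p.embed.2 q.embed.2 := fun _ _ => rfl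
  have hlip : LipschitzWith 1 (PolarSpace.embed : PolarSpace T → ℝ × CPlus T) :=
    LipschitzWith.of_dist_le_mul fun p q => by
      rw [Prod.dist_eq, hdist, NNReal.coe_one, one_mul]
      exact max_le_add_of_nonneg dist_nonneg dist_nonneg
  have hanti : AntilipschitzWith 2 (PolarSpace.embed : PolarSpace T → ℝ × CPlus T) :=
    AntilipschitzWith.of_le_mul_dist fun p q => by
      rw [Prod.dist_eq, hdist, NNReal.coe_ofNat, two_mul]
      exact add_le_add (le_max_left _ _) (le_max_right _ _)
  exact (hanti.isUniformInducing hlip.uniformContinuous).isInducing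

instance PolarSpace.instSecondCountableTopology [SecondCountableTopology C(T, ℝ≥0)] :
    SecondCountableTopology (PolarSpace T) :=
  PolarSpace.isInducing_embed.secondCountableTopology

theorem PolarSpace.continuous_angle : Continuous (PolarSpace.angle : PolarSpace T → CPlus T) :=
  continuous_snd.comp PolarSpace.isInducing_embed.continuous

theorem PolarSpace.continuous_inv_radius :
    Continuous (fun p : PolarSpace T => (p.radius⁻¹).toReal) :=
  continuous_fst.comp PolarSpace.isInducing_embed.continuous

theorem PolarSpace.continuousAt_toCPlus {p : PolarSpace T} (hp : p.radius ≠ ∞) :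
    ContinuousAt (PolarSpace.toCPlus : PolarSpace T → CPlus T) p := by
  rw [funext PolarSpace.toCPlus_eq_inv_smul]
  have hradius := PolarSpace.continuous_inv_radius.continuousAt.inv₀
    (PolarSpace.toReal_inv_radius_ne_zero hp)
  exact (continuous_real_toNNReal.continuousAt.comp hradius).smul
    PolarSpace.continuous_angle.continuousAt

theorem toCPlus_polar (x : {x : CPlus T // x ≠ 0}) : (polar x).toCPlus = x.1 := by
  ext t
  exact congrArg NNReal.toReal (mul_div_cancel₀ _ (CPlus.supNorm_ne_zero x.2))

theorem CPlus.supNorm_le_add_nndist (x y : CPlus T) : x.supNorm ≤ y.supNorm + nndist x y :=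
  ciSup_le' fun t => calc
    x t ≤ y t + nndist (x t) (y t) := by
      rw [← NNReal.coe_le_coe, NNReal.coe_add, coe_nndist, NNReal.dist_eq]
      linarith [le_abs_self ((x t : ℝ) - y t)]
    _ ≤ y.supNorm + nndist x y :=
      add_le_add (y.apply_le_supNorm t) (ContinuousMap.dist_apply_le_dist t)

theorem CPlus.continuous_supNorm : Continuous (CPlus.supNorm : CPlus T → ℝ≥0) := by
  refine LipschitzWith.continuous (K := 1) (LipschitzWith.of_dist_le_mul fun x y => ?_)
  have hxy := NNReal.coe_le_coe.2 (x.supNorm_le_add_nndist y)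
  have hyx := NNReal.coe_le_coe.2 (y.supNorm_le_add_nndist x)
  rw [NNReal.coe_add, coe_nndist] at hxy hyx
  rw [NNReal.coe_one, one_mul, NNReal.dist_eq, abs_sub_le_iff]
  constructor <;> linarith [dist_comm x y]

theorem continuous_polar : Continuous (polar : {x : CPlus T // x ≠ 0} → PolarSpace T) := by
  have hnorm : Continuous fun x : {x : CPlus T // x ≠ 0} => x.1.supNorm :=
    CPlus.continuous_supNorm.comp continuous_subtype_val
  have hne : ∀ x : {x : CPlus T // x ≠ 0}, x.1.supNorm ≠ 0 := fun x => CPlus.supNorm_ne_zero x.2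
  have hembed : ∀ x : {x : CPlus T // x ≠ 0},
      (polar x).embed = ((x.1.supNorm : ℝ)⁻¹, (x.1.supNorm)⁻¹ • x.1) := fun x =>
    Prod.ext (ENNReal.toReal_inv _) (ContinuousMap.ext fun t => div_eq_inv_mul _ _)
  rw [PolarSpace.isInducing_embed.continuous_iff, Function.comp_def, funext hembed]
  exact ((NNReal.continuous_coe.comp hnorm).inv₀ fun x => NNReal.coe_ne_zero.2 (hne x)).prodMk
    ((hnorm.inv₀ hne).smul continuous_subtype_val)

/-- The nonzero functions whose polar decomposition lies in `S`. -/
def polarPreimage (S : Set (PolarSpace T)) : Set (CPlus T) := Subtype.val '' (polar ⁻¹' S)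

theorem mem_polarPreimage {S : Set (PolarSpace T)} {x : CPlus T} :
    x ∈ polarPreimage S ↔ ∃ p ∈ S, p ∈ Set.range polar ∧ p.toCPlus = x := by
  constructor
  · rintro ⟨y, hy, rfl⟩
    exact ⟨_, hy, ⟨y, rfl⟩, toCPlus_polar y⟩
  · rintro ⟨_, hp, ⟨y, rfl⟩, rfl⟩
    exact ⟨y, hp, (toCPlus_polar y).symm⟩

theorem polarPreimage_mono {S S' : Set (PolarSpace T)} (h : S ⊆ S') :
    polarPreimage S ⊆ polarPreimage S' :=
  Set.image_mono (Set.preimage_mono h)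

theorem disjoint_polarPreimage {S S' : Set (PolarSpace T)} (h : Disjoint S S') :
    Disjoint (polarPreimage S) (polarPreimage S') :=
  (Set.disjoint_image_iff Subtype.val_injective).2 (h.preimage _)

theorem measurableSet_polarPreimage {S : Set (PolarSpace T)} (hS : MeasurableSet S) :
    MeasurableSet (polarPreimage S) :=
  measurableEmbedding_subtype_ne_zero.measurableSet_image.2 (continuous_polar.measurable hS)

theorem polarMeasure_apply (μ : Measure (CPlus T)) {S : Set (PolarSpace T)}
    (hS : MeasurableSet S) : polarMeasure μ S = μ (polarPreimage S) := by
  rw [polarMeasure, Measure.map_apply continuous_polar.measurable hS,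
    measurableEmbedding_subtype_ne_zero.comap_apply, polarPreimage]

theorem mem_polarPreimage_of_exists_lt {S : Set (PolarSpace T)} {ε : ℝ≥0}
    (hS : ∀ p, (∃ t, ε < p.toCPlus t) → p ∈ S) {x : CPlus T} (hx : ∃ t, ε < x t) :
    x ∈ polarPreimage S := by
  have hne : x ≠ 0 := by
    rintro rfl
    exact absurd hx (by simp)
  refine ⟨⟨x, hne⟩, hS _ ?_, rfl⟩
  rwa [toCPlus_polar]

end Polar

/-! ### Partitions into continuity sets -/

section Partition

theorem IsBoundedlyFinite.isLocallyFiniteMeasure {E : Type*} [PseudoMetricSpace E]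
    [MeasurableSpace E] [OpensMeasurableSpace E] {μ : Measure E} (hμ : IsBoundedlyFinite μ) :
    IsLocallyFiniteMeasure μ :=
  ⟨fun x => ⟨Metric.ball x 1, Metric.ball_mem_nhds x one_pos,
    hμ _ Metric.isBounded_ball Metric.isOpen_ball.measurableSet⟩⟩

variable {E : Type*} [PseudoMetricSpace E] [MeasurableSpace E]

theorem null_frontier_disjointed {μ : Measure E} {U : ℕ → Set E}
    (hU : ∀ l, μ (frontier (U l)) = 0) (l : ℕ) : μ (frontier (disjointed U l)) = 0 :=
  disjointedRec (p := fun S => μ (frontier S) = 0) (fun {S k} hS => by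
    rw [Set.sdiff_eq]
    exact null_frontier_inter hS (by rw [frontier_compl]; exact hU k)) (hU l)

variable [OpensMeasurableSpace E] {β : Type*} [PseudoMetricSpace β]

theorem exists_isOpen_null_frontier_dist_le (μ : Measure E) [SFinite μ] {f : E → β} {x : E}
    (hf : ContinuousAt f x) {δ : ℝ} (hδ : 0 < δ) :
    ∃ U : Set E, IsOpen U ∧ x ∈ U ∧ μ (frontier U) = 0 ∧ ∀ y ∈ U, dist (f y) (f x) ≤ δ := by
  obtain ⟨s, hs, hball⟩ :=
    Metric.eventually_nhds_iff_ball.1 (Metric.tendsto_nhds.1 hf.tendsto δ hδ)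
  obtain ⟨ρ, hρ, hfrontier⟩ := exists_null_frontier_thickening μ {x} hs
  rw [Metric.thickening_singleton] at hfrontier
  exact ⟨Metric.ball x ρ, Metric.isOpen_ball, Metric.mem_ball_self hρ.1, hfrontier,
    fun y hy => (hball y (Metric.ball_subset_ball hρ.2.le hy)).le⟩

theorem exists_iUnion_null_frontier_dist_le [SecondCountableTopology E] [Nonempty β]
    (μ : Measure E) [SFinite μ] {f : E → β} {R : Set E} (hf : ∀ x ∈ R, ContinuousAt f x) {δ : ℝ}
    (hδ : 0 < δ) :
    ∃ (U : ℕ → Set E) (g : ℕ → β), (∀ l, IsOpen (U l)) ∧ (∀ l, μ (frontier (U l)) = 0) ∧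
      (∀ l, ∀ x ∈ U l, dist (f x) (g l) ≤ δ) ∧ R ⊆ ⋃ l, U l := by
  rcases R.eq_empty_or_nonempty with rfl | ⟨x₀, hx₀⟩
  · exact ⟨fun _ => ∅, fun _ => Classical.arbitrary β, by simp⟩
  have hexists := fun x hx => exists_isOpen_null_frontier_dist_le μ (hf x hx) hδ
  choose! U hU hxU hfrontier hdist using hexists
  obtain ⟨t, htR, htc, ht⟩ := TopologicalSpace.countable_cover_nhdsWithin
    fun x hx => mem_nhdsWithin_of_mem_nhds ((hU x hx).mem_nhds (hxU x hx))
  obtain ⟨x, hx, -⟩ := Set.mem_iUnion₂.1 (ht hx₀)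
  obtain ⟨e, rfl⟩ := htc.exists_eq_range ⟨x, hx⟩
  have heR : ∀ l, e l ∈ R := fun l => htR ⟨l, rfl⟩
  rw [Set.biUnion_range] at ht
  exact ⟨fun l => U (e l), fun l => f (e l), fun l => hU _ (heR l), fun l => hfrontier _ (heR l),
    fun l => hdist _ (heR l), ht⟩

theorem exists_measureReal_sdiff_iUnion_fin_le {F : Type*} [MeasurableSpace F] {μ : Measure F}
    {S : Set F} (hS : MeasurableSet S) (hμS : μ S ≠ ∞) {A : ℕ → Set F}
    (hA : ∀ l, MeasurableSet (A l)) (hnull : μ (S \ ⋃ l, A l) = 0) {δ : ℝ} (hδ : 0 < δ) :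
    ∃ L : ℕ, μ.real (S \ ⋃ l : Fin L, A l) ≤ δ := by
  have hInter : ⋂ L : ℕ, S \ ⋃ l : Fin L, A l = S \ ⋃ l, A l := by
    rw [← Set.sdiff_iUnion]
    congr 1
    ext p
    simp only [Set.mem_iUnion]
    exact ⟨fun ⟨_, l, hl⟩ => ⟨l, hl⟩, fun ⟨l, hl⟩ => ⟨l + 1, Fin.last l, hl⟩⟩
  have hlim := tendsto_measure_iInter_atTop (μ := μ) (s := fun L : ℕ => S \ ⋃ l : Fin L, A l)
    (fun L => (hS.diff (MeasurableSet.iUnion fun l => hA _)).nullMeasurableSet)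
    (fun L L' hL => Set.sdiff_subset_sdiff_right (Set.iUnion_subset fun l =>
      Set.subset_iUnion_of_subset (Fin.castLE hL l) subset_rfl))
    ⟨0, measure_ne_top_of_subset Set.sdiff_subset hμS⟩
  rw [hInter, hnull] at hlim
  obtain ⟨L, hL⟩ := (hlim.eventually_lt_const (ENNReal.ofReal_pos.2 hδ)).exists
  exact ⟨L, ENNReal.toReal_le_of_le_ofReal hδ.le hL.le⟩

end Partition

section ContinuityPartition

variable {T : Type*} [TopologicalSpace T] [CompactSpace T]

/-- `S` is a bounded `ν`-continuity set outside of which the represented functions are at most `ε`,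
and the `A l` are disjoint `ν`-continuity sets in `S` on which the represented functions are within
`ε` of `g l`. The cells `A l` need not exhaust `S`. -/
structure IsContinuityPartition {κ : Type*} (ν : Measure (PolarSpace T)) (ε : ℝ≥0)
    (S : Set (PolarSpace T)) (A : κ → Set (PolarSpace T)) (g : κ → CPlus T) : Prop where
  isBounded : Bornology.IsBounded S
  measurableSet_region : MeasurableSet S
  null_frontier_region : ν (frontier S) = 0
  mem_region : ∀ p : PolarSpace T, (∃ t, ε < p.toCPlus t) → p ∈ S
  measurableSet : ∀ l, MeasurableSet (A l)
  null_frontier : ∀ l, ν (frontier (A l)) = 0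
  subset_region : ∀ l, A l ⊆ S
  pairwise_disjoint : Pairwise (Function.onFun Disjoint A)
  dist_le : ∀ l, ∀ p ∈ A l, dist p.toCPlus (g l) ≤ ε

theorem exists_exceedance_region (ν : Measure (PolarSpace T)) [SFinite ν] {ε : ℝ≥0} (hε : 0 < ε) :
    ∃ S : Set (PolarSpace T), Bornology.IsBounded S ∧ IsOpen S ∧ ν (frontier S) = 0 ∧
      ∀ p : PolarSpace T, (∃ t, ε < p.toCPlus t) → p ∈ S := by
  obtain ⟨ρ, hρ, hfrontier⟩ := exists_null_frontier_thickening ν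
    {p : PolarSpace T | (ε : ℝ≥0∞) ≤ p.radius} one_pos
  refine ⟨_, (PolarSpace.isBounded_le_radius (by exact_mod_cast hε)).thickening,
    Metric.isOpen_thickening, hfrontier, fun p ⟨t, ht⟩ => Metric.self_subset_thickening hρ.1 _ ?_⟩
  exact (ENNReal.coe_le_coe.2 ht.le).trans (p.toCPlus_le_radius t)

theorem exists_isContinuityPartition [SecondCountableTopology C(T, ℝ≥0)]
    {ν : Measure (PolarSpace T)} (hν : IsBoundedlyFinite ν) (hν_top : ν {p | p.radius = ∞} = 0)
    {ε : ℝ≥0} (hε : 0 < ε) {δ : ℝ} (hδ : 0 < δ) :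
    ∃ (L : ℕ) (S : Set (PolarSpace T)) (A : Fin L → Set (PolarSpace T)) (g : Fin L → CPlus T),
      IsContinuityPartition ν ε S A g ∧ ν.real (S \ ⋃ l, A l) ≤ δ := by
  have := hν.isLocallyFiniteMeasure
  obtain ⟨S, hSb, hS, hS_frontier, hS_mem⟩ := exists_exceedance_region ν hε
  obtain ⟨U, g, hU, hU_frontier, hdist, hcover⟩ := exists_iUnion_null_frontier_dist_le ν
    (R := {p : PolarSpace T | p.radius ≠ ∞}) (fun p => PolarSpace.continuousAt_toCPlus)
    (NNReal.coe_pos.2 hε)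
  have hmeas : ∀ l, MeasurableSet (disjointed U l) :=
    MeasurableSet.disjointed fun l => (hU l).measurableSet
  have hnull : ν (S \ ⋃ l, disjointed U l) = 0 := measure_mono_null (fun p hp => by
    rw [iUnion_disjointed] at hp
    exact not_not.1 fun hpr => hp.2 (hcover hpr)) hν_top
  obtain ⟨L, hL⟩ := exists_measureReal_sdiff_iUnion_fin_le hS.measurableSet
    (hν S hSb hS.measurableSet).ne hmeas hnull hδ
  refine ⟨L, S, fun l => disjointed U l ∩ S, fun l => g l, ⟨hSb, hS.measurableSet, hS_frontier,
    hS_mem, fun l => (hmeas l).inter hS.measurableSet,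
    fun l => null_frontier_inter (null_frontier_disjointed hU_frontier l) hS_frontier,
    fun l => Set.inter_subset_right, fun l l' hne => ?_,
    fun l p hp => hdist l p (disjointed_subset U l hp.1)⟩, ?_⟩
  · exact (disjoint_disjointed U (Fin.val_injective.ne hne)).mono Set.inter_subset_left
      Set.inter_subset_left
  · rwa [← Set.iUnion_inter, Set.inter_comm, Set.sdiff_self_inter]

end ContinuityPartition

/-! ### Patterns of independent identically distributed points -/

section PatternProb

variable {κ : Type*}

/-- The probability that `k` independent points, each of which lies in `S` with probability `p` and
in `A l ⊆ S` with probability `a l`, have a given pattern. -/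
def binomialPatternProb (k : ℕ) (p : ℝ) (a : κ → ℝ) : Option κ → ℝ
  | none => (1 - p) ^ k
  | some l => k * a l * (1 - p) ^ (k - 1)

/-- The probability that the points of a Poisson process have a given pattern, if the number of its
points in `S` has mean `p` and the number of its points in `A l ⊆ S` has mean `a l`. -/
def poissonPatternProb (p : ℝ) (a : κ → ℝ) : Option κ → ℝ
  | none => Real.exp (-p)
  | some l => a l * Real.exp (-p)

theorem tendsto_one_sub_pow {p : ℕ → ℝ} {k : ℕ → ℕ} {c h : ℝ} (hp : ∀ n, p n ≤ 1)
    (hpc : Tendsto (fun n : ℕ => n * p n) atTop (𝓝 c))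
    (hk : Tendsto (fun n : ℕ => (k n : ℝ) / n) atTop (𝓝 h)) :
    Tendsto (fun n => (1 - p n) ^ k n) atTop (𝓝 (Real.exp (-(h * c)))) := by
  have hexp : Tendsto (fun n : ℕ => (1 + -p n) ^ n) atTop (𝓝 (Real.exp (-c))) :=
    Real.tendsto_one_add_pow_exp_of_tendsto (by simpa using hpc.neg)
  have hpow := hexp.rpow hk (Or.inl (Real.exp_pos _).ne')
  rw [← Real.exp_mul, neg_mul, mul_comm] at hpow
  refine hpow.congr' ?_
  filter_upwards [eventually_ne_atTop 0] with n hn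
  have hnonneg : 0 ≤ 1 + -p n := by linarith [hp n]
  rw [← Real.rpow_natCast, ← Real.rpow_mul hnonneg, mul_div_cancel₀ _ (Nat.cast_ne_zero.2 hn),
    Real.rpow_natCast, sub_eq_add_neg]

theorem tendsto_natPred_div {k : ℕ → ℕ} {h : ℝ}
    (hk : Tendsto (fun n : ℕ => (k n : ℝ) / n) atTop (𝓝 h)) :
    Tendsto (fun n : ℕ => ((k n - 1 : ℕ) : ℝ) / n) atTop (𝓝 h) := by
  have hsub : Tendsto (fun n : ℕ => (k n : ℝ) / n - 1 / n) atTop (𝓝 h) := by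
    simpa using hk.sub tendsto_one_div_atTop_nhds_zero_nat
  refine tendsto_of_tendsto_of_tendsto_of_le_of_le hsub hk (fun n => ?_) (fun n => ?_)
  · have hle : (k n : ℝ) ≤ ((k n - 1 : ℕ) : ℝ) + 1 := by exact_mod_cast Nat.le_add_of_sub_le le_rfl
    dsimp only
    rw [← sub_div]
    gcongr
    linarith
  · dsimp only
    gcongr
    exact Nat.sub_le _ _

theorem tendsto_binomialPatternProb {p : ℕ → ℝ} {a : ℕ → κ → ℝ} {k : ℕ → ℕ} {c h : ℝ} {c' : κ → ℝ}
    (hp : ∀ n, p n ≤ 1) (hpc : Tendsto (fun n : ℕ => n * p n) atTop (𝓝 c))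
    (ha : ∀ l, Tendsto (fun n : ℕ => n * a n l) atTop (𝓝 (c' l)))
    (hk : Tendsto (fun n : ℕ => (k n : ℝ) / n) atTop (𝓝 h)) (q : Option κ) :
    Tendsto (fun n => binomialPatternProb (k n) (p n) (a n) q) atTop
      (𝓝 (poissonPatternProb (h * c) (fun l => h * c' l) q)) := by
  cases q with
  | none => exact tendsto_one_sub_pow hp hpc hk
  | some l =>
    refine Tendsto.mul ?_ (tendsto_one_sub_pow hp hpc (tendsto_natPred_div hk))
    refine (hk.mul (ha l)).congr' ?_
    filter_upwards [eventually_ne_atTop 0] with n hn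
    have hn' : (n : ℝ) ≠ 0 := Nat.cast_ne_zero.2 hn
    field_simp

end PatternProb

section PatternEvent

theorem iIndep_iSup_of_pairwise_disjoint {Ω ι κ : Type*} {mΩ : MeasurableSpace Ω} {P : Measure Ω}
    {m : ι → MeasurableSpace Ω} (hm : ∀ i, m i ≤ mΩ) (h : iIndep m P) {J : κ → Set ι}
    (hJ : Pairwise (Function.onFun Disjoint J)) : iIndep (fun b => ⨆ i ∈ J b, m i) P := by
  classical
  have := h.isProbabilityMeasure
  rw [iIndep_iff]
  intro s
  induction s using Finset.induction_on with
  | empty => simp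
  | insert b s hb ih =>
    intro f hf
    have hdisj : Disjoint (J b) (⋃ b' ∈ s, J b') :=
      Set.disjoint_iUnion₂_right.2 fun b' hb' => hJ (ne_of_mem_of_not_mem hb' hb).symm
    have hmeas : MeasurableSet[⨆ i ∈ ⋃ b' ∈ s, J b', m i] (⋂ b' ∈ s, f b') := by
      refine Finset.measurableSet_biInter _ fun b' hb' => ?_
      have hle : ⨆ i ∈ J b', m i ≤ ⨆ i ∈ ⋃ b' ∈ s, J b', m i :=
        biSup_mono fun i hi => Set.mem_biUnion hb' hi
      exact hle _ (hf b' (Finset.mem_insert_of_mem hb'))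
    rw [Finset.set_biInter_insert, Finset.prod_insert hb,
      ← ih fun b' hb' => hf b' (Finset.mem_insert_of_mem hb')]
    exact (Indep_iff _ _ _).1 (indep_iSup_of_disjoint hm h hdisj) _ _
      (hf b (Finset.mem_insert_self b s)) hmeas

variable {Ω ι κ α : Type*} {S : Set α} {A : κ → Set α} {X : ι → Ω → α} {J : Finset ι}

/-- The event that the random points `X i`, `i ∈ J`, have the pattern `q`. -/
def patternEvent (X : ι → Ω → α) (S : Set α) (A : κ → Set α) (J : Finset ι) (q : Option κ) :
    Set Ω :=
  {ω | HasPattern (J : Set ι) (fun i => X i ω) S A q}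

theorem patternEvent_none : patternEvent X S A J none = ⋂ i ∈ J, X i ⁻¹' Sᶜ := by
  ext ω
  simp [patternEvent, HasPattern]

theorem patternEvent_some [DecidableEq ι] (l : κ) :
    patternEvent X S A J (some l) =
      ⋃ i ∈ J, ⋂ i' ∈ J, X i' ⁻¹' Function.update (fun _ => Sᶜ) i (A l) i' := by
  ext ω
  simp only [patternEvent, HasPattern, Set.mem_ofPred_eq, Set.mem_iUnion, Set.mem_iInter,
    Set.mem_preimage, Finset.mem_coe, exists_prop]
  refine exists_congr fun i => and_congr_right fun hi => ⟨fun ⟨hil, hunique⟩ i' hi' => ?_,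
    fun h => ⟨by simpa using h i hi, fun i' hi' hiS => ?_⟩⟩
  · rcases eq_or_ne i' i with rfl | hne
    · simpa using hil
    · simpa [hne] using fun hiS => hne (hunique i' hi' hiS)
  · by_contra hne
    exact absurd hiS (by simpa [hne] using h i' hi')

variable [mα : MeasurableSpace α]

theorem measurableSet_iSup_patternEvent (hS : MeasurableSet S)
    (hA : ∀ l, MeasurableSet (A l)) (q : Option κ) :
    MeasurableSet[⨆ i ∈ (J : Set ι), mα.comap (X i)] (patternEvent X S A J q) := by
  classical
  have hpreimage : ∀ i ∈ J, ∀ D : Set α, MeasurableSet D →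
      MeasurableSet[⨆ i ∈ (J : Set ι), mα.comap (X i)] (X i ⁻¹' D) := by
    intro i hi D hD
    have hle : mα.comap (X i) ≤ ⨆ i ∈ (J : Set ι), mα.comap (X i) :=
      le_iSup₂ (f := fun i (_ : i ∈ (J : Set ι)) => mα.comap (X i)) i hi
    exact hle _ ⟨D, hD, rfl⟩
  cases q with
  | none =>
    rw [patternEvent_none]
    exact Finset.measurableSet_biInter _ fun i hi => hpreimage i hi _ hS.compl
  | some l =>
    rw [patternEvent_some]
    refine Finset.measurableSet_biUnion _ fun i _ => Finset.measurableSet_biInter _ fun i' hi' =>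
      hpreimage i' hi' _ ?_
    rw [Function.update_apply]
    split_ifs
    exacts [hA l, hS.compl]

variable [mΩ : MeasurableSpace Ω] {P : Measure Ω} {μ : Measure α}

theorem measurableSet_patternEvent (hX : ∀ i, Measurable (X i)) (hS : MeasurableSet S)
    (hA : ∀ l, MeasurableSet (A l)) (q : Option κ) : MeasurableSet (patternEvent X S A J q) := by
  have hle : ⨆ i ∈ (J : Set ι), mα.comap (X i) ≤ mΩ := iSup₂_le fun i _ => (hX i).comap_le
  exact hle _ (measurableSet_iSup_patternEvent hS hA q)

theorem measureReal_iInter_preimage (hX : ∀ i, Measurable (X i)) (hind : iIndepFun X P)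
    (hid : ∀ i, P.map (X i) = μ) {D : ι → Set α} (hD : ∀ i, MeasurableSet (D i)) :
    P.real (⋂ i ∈ J, X i ⁻¹' D i) = ∏ i ∈ J, μ.real (D i) := by
  rw [measureReal_def, hind.measure_inter_preimage_eq_mul J fun i _ => hD i, ENNReal.toReal_prod]
  refine Finset.prod_congr rfl fun i _ => ?_
  rw [measureReal_def, ← hid i, Measure.map_apply (hX i) (hD i)]

theorem measureReal_patternEvent [IsProbabilityMeasure μ] (hX : ∀ i, Measurable (X i))
    (hind : iIndepFun X P) (hid : ∀ i, P.map (X i) = μ) (hAS : ∀ l, A l ⊆ S)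
    (hS : MeasurableSet S) (hA : ∀ l, MeasurableSet (A l)) (q : Option κ) :
    P.real (patternEvent X S A J q) =
      binomialPatternProb J.card (μ.real S) (fun l => μ.real (A l)) q := by
  classical
  have := hind.isProbabilityMeasure
  cases q with
  | none =>
    rw [patternEvent_none, measureReal_iInter_preimage hX hind hid fun _ => hS.compl,
      Finset.prod_const, probReal_compl_eq_one_sub hS, binomialPatternProb]
  | some l =>
    have hD : ∀ i i' : ι, MeasurableSet (Function.update (fun _ => Sᶜ) i (A l) i') := by
      intro i i'
      rw [Function.update_apply]
      split_ifs
      exacts [hA l, hS.compl]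
    have hsingle : ∀ i ∈ J, P.real (⋂ i' ∈ J, X i' ⁻¹' Function.update (fun _ => Sᶜ) i (A l) i') =
        μ.real (A l) * (1 - μ.real S) ^ (J.card - 1) := by
      intro i hi
      rw [measureReal_iInter_preimage hX hind hid (hD i), ← Finset.mul_prod_erase J _ hi,
        Function.update_self, ← probReal_compl_eq_one_sub hS, ← Finset.card_erase_of_mem hi,
        ← Finset.prod_const]
      congr 1
      refine Finset.prod_congr rfl fun i' hi' => ?_
      rw [Function.update_of_ne (Finset.ne_of_mem_erase hi')]
    rw [patternEvent_some, measureReal_biUnion_finset, Finset.sum_congr rfl hsingle,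
      Finset.sum_const, nsmul_eq_mul, binomialPatternProb, mul_assoc]
    · intro i hi i' _ hne
      refine Set.disjoint_left.2 fun ω hω hω' => ?_
      rw [Set.mem_iInter₂] at hω hω'
      have hmem : X i ω ∈ A l := by simpa using hω i hi
      have hnotMem : X i ω ∉ S := by simpa [hne] using hω' i hi
      exact hnotMem (hAS l hmem)
    · exact fun i _ => Finset.measurableSet_biInter _ fun i' _ => hX i' (hD i i')

theorem measureReal_iInter_patternEvent {β : Type*} [Fintype β] [IsProbabilityMeasure μ]
    (hX : ∀ i, Measurable (X i)) (hind : iIndepFun X P) (hid : ∀ i, P.map (X i) = μ)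
    (hAS : ∀ l, A l ⊆ S) (hS : MeasurableSet S) (hA : ∀ l, MeasurableSet (A l))
    {J : β → Finset ι} (hJ : Pairwise (Function.onFun Disjoint J)) (q : β → Option κ) :
    P.real (⋂ b, patternEvent X S A (J b) (q b)) =
      ∏ b, binomialPatternProb (J b).card (μ.real S) (fun l => μ.real (A l)) (q b) := by
  have hJ' : Pairwise (Function.onFun Disjoint fun b => (J b : Set ι)) :=
    fun b b' hb => Finset.disjoint_coe.2 (hJ hb)
  have hindep := iIndep_iSup_of_pairwise_disjoint (fun i => (hX i).comap_le) hind.iIndep hJ'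
  rw [measureReal_def, hindep.meas_iInter fun b => measurableSet_iSup_patternEvent hS hA (q b),
    ENNReal.toReal_prod]
  exact Finset.prod_congr rfl fun b _ => measureReal_patternEvent hX hind hid hAS hS hA (q b)

end PatternEvent

section TimeBlock

/-- The indices of the points of the `n`-th row whose time lies in the time cell `b`. -/
def timeBlock (h : ℝ≥0) (n b : ℕ) : Finset ℕ :=
  Finset.Ico ⌊(n : ℝ≥0) * (b * h)⌋₊ ⌊(n : ℝ≥0) * (((b + 1 : ℕ) : ℝ≥0) * h)⌋₊

theorem mem_timeBlock {n : ℕ} (hn : n ≠ 0) {h : ℝ≥0} {b i : ℕ} :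
    i ∈ timeBlock h n b ↔ ((i : ℝ≥0) + 1) / n ∈ timeCell h b := by
  rw [timeBlock, timeCell, Finset.mem_Ico, Set.mem_Ioc, ← not_lt, ← arrayTime_le_iff hn, not_le,
    ← arrayTime_le_iff hn, Nat.cast_add_one]

theorem pairwise_disjoint_timeBlock {n : ℕ} (hn : n ≠ 0) (h : ℝ≥0) :
    Pairwise (Function.onFun Disjoint (timeBlock h n)) :=
  fun _ _ hb => Finset.disjoint_left.2 fun _ hi hi' =>
    hb (timeCell_unique ((mem_timeBlock hn).1 hi) ((mem_timeBlock hn).1 hi'))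

theorem tendsto_card_timeBlock_div (h : ℝ≥0) (b : ℕ) :
    Tendsto (fun n : ℕ => ((timeBlock h n b).card : ℝ) / n) atTop (𝓝 h) := by
  have hfloor : ∀ b : ℕ, Tendsto (fun n : ℕ => (⌊(n : ℝ≥0) * (b * h)⌋₊ : ℝ) / n) atTop
      (𝓝 (b * h)) := by
    intro b
    have htendsto := (tendsto_nat_floor_mul_div_atTop (R := ℝ) (a := b * h) (by positivity)).comp
      tendsto_natCast_atTop_atTop
    refine htendsto.congr fun n => ?_
    have hcast : ⌊(n : ℝ≥0) * (b * h)⌋₊ = ⌊(((n : ℝ≥0) * (b * h) : ℝ≥0) : ℝ)⌋₊ :=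
      (Nonneg.nat_floor_coe _).symm
    rw [Function.comp_apply, hcast, mul_comm]
    rfl
  have hdiff : ((b + 1 : ℕ) : ℝ) * h - b * h = h := by push_cast; ring
  have hsub := (hfloor (b + 1)).sub (hfloor b)
  rw [hdiff] at hsub
  refine hsub.congr fun n => ?_
  rw [timeBlock, Nat.card_Ico, Nat.cast_sub, sub_div]
  refine Nat.floor_mono ?_
  gcongr
  exact Nat.le_succ b

theorem arrayTime_ne_gridTime {h : ℝ≥0} (hirr : Irrational h) {n : ℕ} (hn : n ≠ 0) (i b : ℕ) :
    ((i : ℝ≥0) + 1) / n ≠ b * h := by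
  intro heq
  have hn' : (n : ℝ) ≠ 0 := Nat.cast_ne_zero.2 hn
  have hmul : ((i + 1 : ℕ) : ℝ) = ((n * b : ℕ) : ℝ) * h := by
    rw [← NNReal.coe_inj] at heq
    push_cast at heq ⊢
    rw [div_eq_iff hn'] at heq
    rw [heq]
    ring
  have hb : n * b ≠ 0 := by
    rintro hb
    rw [hb] at hmul
    norm_num at hmul
    linarith [(Nat.cast_nonneg i : (0 : ℝ) ≤ i)]
  exact (hirr.natCast_mul hb).ne_nat (i + 1) hmul.symm

end TimeBlock

/-! ### Patterns of a Poisson process -/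

section LebesgueHalfLine

theorem lebesgueHalfLine_apply (S : Set ℝ≥0) :
    lebesgueHalfLine S = volume ((↑) '' S : Set ℝ) :=
  NNReal.isClosedEmbedding_coe.measurableEmbedding.comap_apply _ _

theorem lebesgueHalfLine_Ioc (a b : ℝ≥0) :
    lebesgueHalfLine (Set.Ioc a b) = ENNReal.ofReal (b - a) := by
  rw [lebesgueHalfLine_apply, NNReal.image_coe_Ioc, Real.volume_Ioc]

theorem lebesgueHalfLine_timeCell (h : ℝ≥0) (b : ℕ) : lebesgueHalfLine (timeCell h b) = h := by
  have hlength : (((b + 1) * h : ℝ≥0) : ℝ) - (b * h : ℝ≥0) = h := by push_cast; ring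
  rw [timeCell, lebesgueHalfLine_Ioc, hlength, ENNReal.ofReal_coe_nnreal]

theorem lebesgueHalfLine_eq_zero_of_countable {S : Set ℝ≥0} (hS : S.Countable) :
    lebesgueHalfLine S = 0 := by
  rw [lebesgueHalfLine_apply]
  exact (hS.image _).measure_zero _

instance : IsLocallyFiniteMeasure lebesgueHalfLine := by
  refine ⟨fun u => ⟨Set.Iio (u + 1), Iio_mem_nhds (lt_add_one u), ?_⟩⟩
  rw [lebesgueHalfLine_apply, NNReal.image_coe_Iio]
  exact measure_Ico_lt_top

end LebesgueHalfLine

section PatternCell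

variable {E κ : Type*} {S : Set E} {A : κ → Set E}

/-- The sets in which the points have to be counted in order to see whether they have the
pattern `q`. -/
def patternCell (S : Set E) (A : κ → Set E) (q : Option κ) : Bool → Set E
  | true => q.elim ∅ A
  | false => S \ q.elim ∅ A

/-- The number of points with pattern `q` in each set `patternCell S A q`. -/
def patternCount : Option κ → Bool → ℕ
  | some _, true => 1
  | _, _ => 0

theorem patternCell_subset (hAS : ∀ l, A l ⊆ S) (q : Option κ) (z : Bool) :
    patternCell S A q z ⊆ S := by
  cases z with
  | false => exact Set.sdiff_subset
  | true =>
    cases q with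
    | none => exact Set.empty_subset S
    | some l => exact hAS l

theorem disjoint_patternCell (S : Set E) (A : κ → Set E) (q : Option κ) :
    Pairwise (Function.onFun Disjoint (patternCell S A q)) := by
  rintro (_ | _) (_ | _) hz
  · exact absurd rfl hz
  · exact Set.disjoint_sdiff_left
  · exact Set.disjoint_sdiff_right
  · exact absurd rfl hz

variable [MeasurableSpace E] {μ : Measure E}

theorem measurableSet_patternCell (hS : MeasurableSet S) (hA : ∀ l, MeasurableSet (A l))
    (q : Option κ) (z : Bool) : MeasurableSet (patternCell S A q z) := by
  have helim : MeasurableSet (q.elim ∅ A) := by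
    cases q with
    | none => exact MeasurableSet.empty
    | some l => exact hA l
  cases z with
  | false => exact hS.diff helim
  | true => exact helim

theorem prod_patternCell (hAS : ∀ l, A l ⊆ S) (hA : ∀ l, MeasurableSet (A l)) (hμS : μ S ≠ ∞)
    (q : Option κ) :
    ∏ z, Real.exp (-μ.real (patternCell S A q z)) * μ.real (patternCell S A q z) ^
        patternCount q z / (patternCount q z).factorial =
      poissonPatternProb (μ.real S) (fun l => μ.real (A l)) q := by
  cases q with
  | none => simp [patternCell, patternCount, poissonPatternProb]
  | some l =>
    have hexp : Real.exp (-μ.real S) =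
        Real.exp (-μ.real (A l)) * Real.exp (-μ.real (S \ A l)) := by
      rw [measureReal_sdiff (hAS l) (hA l) hμS, ← Real.exp_add]
      ring_nf
    simp only [Fintype.prod_bool, patternCell, patternCount, poissonPatternProb, Option.elim_some,
      pow_one, pow_zero, mul_one, Nat.factorial_one, Nat.factorial_zero, Nat.cast_one, div_one,
      hexp]
    ring

end PatternCell

section CountPattern

variable {Ω E κ ι : Type*} [MeasurableSpace E] {N : Ω → Measure E} {S : Set E} {A : κ → Set E}

/-- The event that the points of the random point measure `N` have the pattern `q`. -/
def countPatternEvent (N : Ω → Measure E) (S : Set E) (A : κ → Set E) (q : Option κ) : Set Ω :=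
  {ω | ∀ z, N ω (patternCell S A q z) = patternCount q z}

variable [MeasurableSingletonClass E] [Countable ι] {x : ι → E} {ω : Ω}

theorem mem_countPatternEvent_iff (hAS : ∀ l, A l ⊆ S)
    (hx : N ω = Measure.sum fun i => Measure.dirac (x i)) (q : Option κ) :
    ω ∈ countPatternEvent N S A q ↔ HasPattern Set.univ x S A q := by
  have hzero : ∀ B, N ω B = 0 ↔ ∀ i, x i ∉ B := fun B => by
    rw [hx, sum_dirac_apply]
    simp [Set.eq_empty_iff_forall_notMem]
  have hone : ∀ B, N ω B = 1 ↔ ∃ i, ∀ i', x i' ∈ B ↔ i' = i := fun B => by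
    rw [hx, sum_dirac_apply, ← ENat.toENNReal_one, ENat.toENNReal_inj, Set.encard_eq_one]
    simp only [Set.ext_iff, Set.mem_ofPred_eq, Set.mem_singleton_iff]
  cases q with
  | none => simp [countPatternEvent, patternCell, patternCount, HasPattern, hzero]
  | some l =>
    simp only [countPatternEvent, patternCell, patternCount, HasPattern, Set.mem_ofPred_eq,
      Bool.forall_bool, Option.elim_some, Nat.cast_zero, Nat.cast_one, hzero, hone, Set.mem_univ,
      true_and, true_imp_iff]
    constructor
    · rintro ⟨hdiff, i, hi⟩
      exact ⟨i, (hi i).2 rfl, fun i' hi' => (hi i').1 (by_contra fun h => hdiff i' ⟨hi', h⟩)⟩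
    · rintro ⟨i, hi, hunique⟩
      refine ⟨fun i' hi' => hi'.2 (hunique i' hi'.1 ▸ hi), i, fun i' => ⟨fun h => ?_, ?_⟩⟩
      · exact hunique i' (hAS l h)
      · rintro rfl
        exact hi

theorem exists_mem_countPatternEvent (hAS : ∀ l, A l ⊆ S)
    (hx : N ω = Measure.sum fun i => Measure.dirac (x i)) (hS : N ω S = 0 ∨ N ω S = 1)
    (hSA : N ω (S \ ⋃ l, A l) = 0) : ∃ q, ω ∈ countPatternEvent N S A q := by
  rcases hS with hS | hS
  · exact ⟨none, by simp [countPatternEvent, patternCell, patternCount, hS]⟩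
  · rw [hx, sum_dirac_apply, ← ENat.toENNReal_one, ENat.toENNReal_inj, Set.encard_eq_one] at hS
    rw [hx, sum_dirac_apply, ENat.toENNReal_eq_zero, Set.encard_eq_zero] at hSA
    obtain ⟨i, hi⟩ := hS
    have hiS : x i ∈ S := Set.mem_ofPred.1 (hi.symm.subset (Set.mem_singleton i))
    have hiA : x i ∈ ⋃ l, A l :=
      by_contra fun h => Set.eq_empty_iff_forall_notMem.1 hSA i ⟨hiS, h⟩
    obtain ⟨l, hl⟩ := Set.mem_iUnion.1 hiA
    exact ⟨some l, (mem_countPatternEvent_iff hAS hx _).2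
      ⟨i, Set.mem_univ i, hl, fun i' _ hi' => hi.subset hi'⟩⟩

end CountPattern

section PoissonProcess

variable {Ω E κ β : Type*} [MeasurableSpace Ω] [PseudoMetricSpace E] [MeasurableSpace E]
  {N : Ω → Measure E} {μ : Measure E} {P : Measure Ω}

theorem IsPoissonPointProcess.measurableSet_eq (hN : IsPoissonPointProcess N μ P) {S : Set E}
    (hS : MeasurableSet S) (c : ℝ≥0∞) : MeasurableSet {ω | N ω S = c} :=
  (Measure.measurable_coe hS).comp hN.measurable (measurableSet_singleton c)

theorem IsPoissonPointProcess.measureReal_eq (hN : IsPoissonPointProcess N μ P) {S : Set E}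
    (hS : MeasurableSet S) (hμS : μ S ≠ ∞) (k : ℕ) :
    P.real {ω | N ω S = k} = Real.exp (-μ.real S) * μ.real S ^ k / k.factorial := by
  have hmeas : Measurable fun ω => N ω S := (Measure.measurable_coe hS).comp hN.measurable
  have hmap : P {ω | N ω S = k} = P.map (fun ω => N ω S) {(k : ℝ≥0∞)} :=
    (Measure.map_apply hmeas (measurableSet_singleton _)).symm
  have hpreimage : (Nat.cast : ℕ → ℝ≥0∞) ⁻¹' {(k : ℝ≥0∞)} = {k} := by
    ext j
    simp
  rw [measureReal_def, hmap, hN.law S hS hμS, Measure.map_apply (by fun_prop)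
    (measurableSet_singleton _), hpreimage, ← measureReal_def, poissonMeasure_real_singleton]
  rfl

theorem IsPoissonPointProcess.measureReal_ne_zero_le [IsProbabilityMeasure P]
    (hN : IsPoissonPointProcess N μ P) {S : Set E} (hS : MeasurableSet S) (hμS : μ S ≠ ∞) :
    P.real {ω | N ω S ≠ 0} ≤ μ.real S := by
  have hzero : P.real {ω | N ω S = 0} = Real.exp (-μ.real S) := by
    simpa using hN.measureReal_eq hS hμS 0
  calc P.real {ω | N ω S ≠ 0} = 1 - P.real {ω | N ω S = 0} :=
        probReal_compl_eq_one_sub (hN.measurableSet_eq hS 0)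
    _ ≤ μ.real S := by rw [hzero]; linarith [Real.one_sub_le_exp_neg (μ.real S)]

theorem IsPoissonPointProcess.measureReal_ne_zero_one_le [IsProbabilityMeasure P]
    (hN : IsPoissonPointProcess N μ P) {S : Set E} (hS : MeasurableSet S) (hμS : μ S ≠ ∞) :
    P.real {ω | N ω S ≠ 0 ∧ N ω S ≠ 1} ≤ μ.real S ^ 2 := by
  have hzero : P.real {ω | N ω S = 0} = Real.exp (-μ.real S) := by
    simpa using hN.measureReal_eq hS hμS 0
  have hone : P.real {ω | N ω S = 1} = Real.exp (-μ.real S) * μ.real S := by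
    simpa using hN.measureReal_eq hS hμS 1
  have hdisj : Disjoint {ω | N ω S = 0} {ω | N ω S = 1} :=
    Set.disjoint_left.2 fun ω h₀ h₁ => zero_ne_one ((Set.mem_ofPred.1 h₀).symm.trans h₁)
  have hcompl : {ω | N ω S ≠ 0 ∧ N ω S ≠ 1} = ({ω | N ω S = 0} ∪ {ω | N ω S = 1})ᶜ := by
    ext ω
    simp
  rw [hcompl, probReal_compl_eq_one_sub ((hN.measurableSet_eq hS 0).union
    (hN.measurableSet_eq hS 1)), measureReal_union hdisj (hN.measurableSet_eq hS 1), hzero, hone]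
  nlinarith [Real.one_sub_le_exp_neg (μ.real S), measureReal_nonneg (μ := μ) (s := S)]

theorem IsPoissonPointProcess.ae_eq_zero [IsProbabilityMeasure P]
    (hN : IsPoissonPointProcess N μ P) {S : Set E} (hS : MeasurableSet S) (hμS : μ S = 0) :
    ∀ᵐ ω ∂P, N ω S = 0 := by
  have hle := hN.measureReal_ne_zero_le hS (hμS ▸ ENNReal.zero_ne_top)
  rw [measureReal_def μ, hμS, ENNReal.toReal_zero] at hle
  exact (measureReal_eq_zero_iff).1 (hle.antisymm measureReal_nonneg)

theorem IsPoissonPointProcess.measureReal_forall_eq (hN : IsPoissonPointProcess N μ P) [Fintype κ]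
    {B : κ → Set E} (hB : ∀ z, MeasurableSet (B z)) (hd : Pairwise (Function.onFun Disjoint B))
    (hμB : ∀ z, μ (B z) ≠ ∞) (c : κ → ℕ) :
    P.real {ω | ∀ z, N ω (B z) = c z} =
      ∏ z, Real.exp (-μ.real (B z)) * μ.real (B z) ^ c z / (c z).factorial := by
  let e := Fintype.equivFin κ
  have hindep : iIndepFun (fun i ω => N ω (B (e.symm i))) P :=
    hN.indep _ _ (fun i => hB _) (hd.comp_of_injective e.symm.injective)
  have hset : {ω | ∀ z, N ω (B z) = c z} = ⋂ i ∈ (Finset.univ : Finset (Fin (Fintype.card κ))),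
      (fun ω => N ω (B (e.symm i))) ⁻¹' {(c (e.symm i) : ℝ≥0∞)} := by
    ext ω
    simp [e.symm.forall_congr_left]
  rw [hset, measureReal_def, hindep.measure_inter_preimage_eq_mul _
    (fun i _ => measurableSet_singleton _), ENNReal.toReal_prod, ← e.symm.prod_comp]
  exact Finset.prod_congr rfl fun i _ => hN.measureReal_eq (hB _) (hμB _) _

variable {S : β → Set E} {A : β → κ → Set E}

theorem IsPoissonPointProcess.measurableSet_countPatternEvent (hN : IsPoissonPointProcess N μ P)
    {S : Set E} {A : κ → Set E} (hS : MeasurableSet S) (hA : ∀ l, MeasurableSet (A l))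
    (q : Option κ) : MeasurableSet (countPatternEvent N S A q) := by
  have hset : countPatternEvent N S A q =
      ⋂ z, {ω | N ω (patternCell S A q z) = patternCount q z} := by
    ext ω
    simp [countPatternEvent]
  rw [hset]
  exact MeasurableSet.iInter fun z => hN.measurableSet_eq (measurableSet_patternCell hS hA q z) _

theorem IsPoissonPointProcess.measureReal_iInter_countPatternEvent [Fintype β]
    (hN : IsPoissonPointProcess N μ P) (hS : ∀ b, MeasurableSet (S b)) (hμS : ∀ b, μ (S b) ≠ ∞)
    (hdS : Pairwise (Function.onFun Disjoint S)) (hA : ∀ b l, MeasurableSet (A b l))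
    (hAS : ∀ b l, A b l ⊆ S b) (q : β → Option κ) :
    P.real (⋂ b, countPatternEvent N (S b) (A b) (q b)) =
      ∏ b, poissonPatternProb (μ.real (S b)) (fun l => μ.real (A b l)) (q b) := by
  let B : β × Bool → Set E := fun z => patternCell (S z.1) (A z.1) (q z.1) z.2
  have hBS : ∀ z, B z ⊆ S z.1 := fun z => patternCell_subset (hAS z.1) _ _
  have hd : Pairwise (Function.onFun Disjoint B) := by
    rintro ⟨b, z⟩ ⟨b', z'⟩ hne
    rcases eq_or_ne b b' with rfl | hb
    · exact disjoint_patternCell _ _ _ fun hz => hne (congrArg (b, ·) hz)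
    · exact (hdS hb).mono (hBS _) (hBS _)
  have hset : ⋂ b, countPatternEvent N (S b) (A b) (q b) =
      {ω | ∀ z, N ω (B z) = patternCount (q z.1) z.2} := by
    ext ω
    simp [countPatternEvent, B]
  rw [hset, hN.measureReal_forall_eq (fun z => measurableSet_patternCell (hS _) (hA _) _ _) hd
    (fun z => measure_ne_top_of_subset (hBS z) (hμS _)) fun z => patternCount (q z.1) z.2,
    Fintype.prod_prod_type]
  exact Finset.prod_congr rfl fun b _ => prod_patternCell (hAS b) (hA b) (hμS b) (q b)

theorem IsPoissonPointProcess.pairwise_disjoint_iInter_countPatternEvent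
    [MeasurableSingletonClass E] (hN : IsPoissonPointProcess N μ P) (hAS : ∀ b l, A b l ⊆ S b)
    (hdA : ∀ b, Pairwise (Function.onFun Disjoint (A b))) :
    Pairwise (Function.onFun Disjoint fun q : β → Option κ =>
      ⋂ b, countPatternEvent N (S b) (A b) (q b)) := by
  intro q q' hne
  refine Set.disjoint_left.2 fun ω hω hω' => hne (funext fun b => ?_)
  obtain ⟨I, x, -, hx⟩ := hN.pointMeasure ω
  have hpattern := (mem_countPatternEvent_iff (hAS b) hx _).1 (Set.mem_iInter.1 hω b)
  have hpattern' := (mem_countPatternEvent_iff (hAS b) hx _).1 (Set.mem_iInter.1 hω' b)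
  exact hpattern.unique (hAS b) (hdA b) hpattern'

theorem IsPoissonPointProcess.measureReal_compl_iUnion_countPatternEvent_le [Fintype β]
    [Countable κ] [IsProbabilityMeasure P] [MeasurableSingletonClass E]
    (hN : IsPoissonPointProcess N μ P) (hS : ∀ b, MeasurableSet (S b)) (hμS : ∀ b, μ (S b) ≠ ∞)
    (hA : ∀ b l, MeasurableSet (A b l)) (hAS : ∀ b l, A b l ⊆ S b) :
    P.real (⋃ q : β → Option κ, ⋂ b, countPatternEvent N (S b) (A b) (q b))ᶜ ≤
      ∑ b, (μ.real (S b) ^ 2 + μ.real (S b \ ⋃ l, A b l)) := by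
  let bad : β → Set Ω := fun b =>
    {ω | N ω (S b) ≠ 0 ∧ N ω (S b) ≠ 1} ∪ {ω | N ω (S b \ ⋃ l, A b l) ≠ 0}
  have hsub : (⋃ q : β → Option κ, ⋂ b, countPatternEvent N (S b) (A b) (q b))ᶜ ⊆ ⋃ b, bad b := by
    intro ω hω
    by_contra hgood
    simp only [bad, Set.mem_iUnion, Set.mem_union, Set.mem_ofPred_eq, not_exists, not_or, not_and,
      not_not, ← or_iff_not_imp_left] at hgood
    obtain ⟨I, x, -, hx⟩ := hN.pointMeasure ω
    choose q hq using fun b =>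
      exists_mem_countPatternEvent (hAS b) hx (hgood b).1 (hgood b).2
    exact hω (Set.mem_iUnion.2 ⟨q, Set.mem_iInter.2 hq⟩)
  have hbad : ∀ b, P.real (bad b) ≤ μ.real (S b) ^ 2 + μ.real (S b \ ⋃ l, A b l) := fun b =>
    (measureReal_union_le _ _).trans <| add_le_add
      (hN.measureReal_ne_zero_one_le (hS b) (hμS b))
      (hN.measureReal_ne_zero_le ((hS b).diff (MeasurableSet.iUnion (hA b)))
        (measure_ne_top_of_subset Set.sdiff_subset (hμS b)))
  calc P.real (⋃ q : β → Option κ, ⋂ b, countPatternEvent N (S b) (A b) (q b))ᶜ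
      ≤ P.real (⋃ b, bad b) := measureReal_mono hsub
    _ ≤ ∑ b, P.real (bad b) := measureReal_iUnion_fintype_le _
    _ ≤ _ := Finset.sum_le_sum fun b _ => hbad b

end PoissonProcess

/-! ### Finite approximation of the array and of the Poisson process -/

theorem exists_irrational_mesh (a : ℝ≥0) {ε : ℝ≥0} (hε : 0 < ε) (c : ℝ) {η : ℝ} (hη : 0 < η) :
    ∃ (h : ℝ≥0) (m : ℕ), 0 < h ∧ Irrational h ∧ h ≤ ε ∧ a ≤ m * h ∧ (m * h : ℝ) ≤ a + 1 ∧
      m * (c * h) ^ 2 ≤ η := by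
  have hpos : 0 < min (min (ε : ℝ) 1) (η / ((a + 1) * (c ^ 2 + 1))) := by positivity
  obtain ⟨h, hirr, hh, hlt⟩ := exists_irrational_btwn hpos
  obtain ⟨⟨hhε, hh1⟩, hhη⟩ := (lt_min_iff.1 hlt).imp_left lt_min_iff.1
  lift h to ℝ≥0 using hh.le
  have hlower : (a : ℝ) ≤ ⌈(a / h : ℝ)⌉₊ * h := (div_le_iff₀ hh).1 (Nat.le_ceil _)
  have hupper : (⌈(a / h : ℝ)⌉₊ * h : ℝ) ≤ a + 1 :=
    calc (⌈(a / h : ℝ)⌉₊ * h : ℝ) ≤ (a / h + 1) * h := by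
          gcongr
          exact (Nat.ceil_lt_add_one (by positivity)).le
      _ = a + h := by field_simp
      _ ≤ a + 1 := by gcongr
  refine ⟨h, ⌈(a / h : ℝ)⌉₊, hh, hirr, hhε.le, by exact_mod_cast hlower, hupper, ?_⟩
  calc (⌈(a / h : ℝ)⌉₊ : ℝ) * (c * h) ^ 2 = (⌈(a / h : ℝ)⌉₊ * h) * (h * c ^ 2) := by ring
    _ ≤ (a + 1) * (h * (c ^ 2 + 1)) := by
        gcongr
        exact le_add_of_nonneg_right zero_le_one
    _ = h * ((a + 1) * (c ^ 2 + 1)) := by ring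
    _ ≤ η := ((lt_div_iff₀ (by positivity)).1 hhη).le

theorem hasPattern_univ_prod_iff {ι κ F G : Type*} {x : ι → F × G} {S : Set F} {A : κ → Set F}
    {I : Set G} {q : Option κ} :
    HasPattern Set.univ x (S ×ˢ I) (fun l => A l ×ˢ I) q ↔
      HasPattern {i | (x i).2 ∈ I} (fun i => (x i).1) S A q := by
  cases q with
  | none => simp only [HasPattern, Set.mem_univ, true_imp_iff, Set.mem_prod, not_and',
      Set.mem_ofPred_eq]
  | some l => simp only [HasPattern, Set.mem_univ, true_and, true_imp_iff, Set.mem_prod,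
      and_comm (b := _ ∈ I), and_imp, and_assoc, Set.mem_ofPred_eq]

theorem IsDiscretisation.mono {Ω D κ : Type*} [MeasurableSpace Ω] {P : Measure Ω} {Y : Ω → D}
    {V V' : Set (D × D)} {y : κ → D} {A : κ → Set Ω} (h : IsDiscretisation P Y V y A)
    (hV : V ⊆ V') : IsDiscretisation P Y V' y A :=
  ⟨h.measurableSet, h.pairwise_disjoint, fun k => (h.ae_mem k).mono fun _ hω hA => hV (hω hA)⟩

section Array

variable {T : Type*} [TopologicalSpace T] {κ : Type*} {m : ℕ} {S : Set (PolarSpace T)}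
  {A : κ → Set (PolarSpace T)} {h : ℝ≥0}

theorem hasPattern_arrayPoint_iff {n : ℕ} (hn : n ≠ 0) {x : ℕ → CPlus T} {S : Set (CPlus T)}
    {A : κ → Set (CPlus T)} {b : ℕ} {q : Option κ} :
    HasPattern {i | (arrayPoint n x i).2 ∈ timeCell h b} (fun i => (arrayPoint n x i).1) S A q ↔
      HasPattern (timeBlock h n b : Set ℕ) x S A q := by
  have htime : {i | (arrayPoint n x i).2 ∈ timeCell h b} = (timeBlock h n b : Set ℕ) :=
    Set.ext fun i => (mem_timeBlock hn).symm
  have hvalue : (fun i => (arrayPoint n x i).1) = x := funext fun i => if_neg hn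
  rw [htime, hvalue]

variable [CompactSpace T]

/-- The event that, for each `b < m`, the functions of the `n`-th row with time in the time cell `b`
have the pattern `q b`. -/
def arrayPatternEvent {Ω : Type*} (X : ℕ → Ω → CPlus T) (S : Set (PolarSpace T))
    (A : κ → Set (PolarSpace T)) (h : ℝ≥0) (n : ℕ) (q : Fin m → Option κ) : Set Ω :=
  ⋂ b : Fin m, patternEvent X (polarPreimage S) (fun l => polarPreimage (A l)) (timeBlock h n b)
    (q b)

variable {ν : Measure (PolarSpace T)} {ε a : ℝ≥0} {g : κ → CPlus T}

theorem IsContinuityPartition.isDiscretisation_arrayPath (hp : IsContinuityPartition ν ε S A g)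
    {Ω : Type*} [MeasurableSpace Ω] (P : Measure Ω) {X : ℕ → Ω → CPlus T}
    (hX : ∀ i, Measurable (X i)) (hh : 0 < h) (hirr : Irrational h) (hhε : h ≤ ε) (ha : a ≤ m * h)
    (r : ℕ) {n : ℕ} (hn : n ≠ 0) :
    IsDiscretisation P (fun ω => arrayPath n r fun i => X i ω)
      (SkorokhodSpace.entourage (Fin r → CPlus T) a ε) (patternPath g h r)
      (arrayPatternEvent (m := m) X S A h n) where
  measurableSet q := MeasurableSet.iInter fun b => measurableSet_patternEvent hX
    (measurableSet_polarPreimage hp.measurableSet_region)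
    (fun l => measurableSet_polarPreimage (hp.measurableSet l)) (q b)
  pairwise_disjoint q q' hne := Set.disjoint_left.2 fun ω hω hω' => hne <| funext fun b =>
    HasPattern.unique (fun l => polarPreimage_mono (hp.subset_region l))
      (fun _ _ hl => disjoint_polarPreimage (hp.pairwise_disjoint hl))
      (Set.mem_iInter.1 hω b) (Set.mem_iInter.1 hω' b)
  ae_mem q := ae_of_all _ fun ω hω => by
    refine orderPath_patternPath_mem_entourage (φ := id) (x := arrayPoint n fun i => X i ω)
      (locallyFinitelyLarge_arrayPoint n _) (S := polarPreimage S)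
      (fun p => mem_polarPreimage_of_exists_lt hp.mem_region)
      (fun l => polarPreimage_mono (hp.subset_region l)) ?_ hh hhε ha
      (fun i _ b => arrayTime_ne_gridTime hirr hn i b)
      (fun b => (hasPattern_arrayPoint_iff hn).2 (Set.mem_iInter.1 hω b)) r
    intro l x hx
    obtain ⟨p, hpA, -, rfl⟩ := mem_polarPreimage.1 hx
    exact hp.dist_le l p hpA

variable {Ω : ℕ → Type*} [∀ n, MeasurableSpace (Ω n)] {P : (n : ℕ) → Measure (Ω n)}
  [∀ n, IsProbabilityMeasure (P n)] {X : (n : ℕ) → ℕ → Ω n → CPlus T}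

theorem tendsto_mul_measureReal_polarPreimage {μ : ℕ → Measure (CPlus T)}
    [∀ n, IsFiniteMeasure (μ n)] (hν : IsBoundedlyFinite ν)
    (hμ : TendstoSharpWeakly (fun n => (n : ℝ≥0∞) • polarMeasure (μ n)) ν)
    (hSb : Bornology.IsBounded S) (hS : MeasurableSet S) (hfr : ν (frontier S) = 0) :
    Tendsto (fun n => n * (μ n).real (polarPreimage S)) atTop (𝓝 (ν.real S)) := by
  have hfin : ∀ n : ℕ, IsBoundedlyFinite ((n : ℝ≥0∞) • polarMeasure (μ n)) := by
    intro n B _ hB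
    rw [Measure.smul_apply, polarMeasure_apply _ hB]
    exact ENNReal.mul_lt_top (ENNReal.natCast_lt_top n) (measure_lt_top _ _)
  refine (hμ.tendsto_measureReal hfin hν hSb hS hfr).congr fun n => ?_
  rw [measureReal_ennreal_smul_apply, ENNReal.toReal_natCast, measureReal_def,
    polarMeasure_apply _ hS, measureReal_def]

theorem IsContinuityPartition.tendsto_measureReal_arrayPatternEvent
    (hp : IsContinuityPartition ν ε S A g) (hX_meas : ∀ n i, Measurable (X n i))
    (hX_indep : ∀ n, iIndepFun (X n) (P n))
    (hX_ident : ∀ n i, IdentDistrib (X n i) (X n 0) (P n) (P n)) (hν : IsBoundedlyFinite ν)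
    (hX_lim : TendstoSharpWeakly
      (fun n => (n : ℝ≥0∞) • polarMeasure ((P n).map (X n 0))) ν) (h : ℝ≥0)
    (q : Fin m → Option κ) :
    Tendsto (fun n => (P n).real (arrayPatternEvent (X n) S A h n q)) atTop
      (𝓝 (∏ b, poissonPatternProb (h * ν.real S) (fun l => h * ν.real (A l)) (q b))) := by
  have hprob : ∀ n, IsProbabilityMeasure ((P n).map (X n 0)) := fun n =>
    Measure.isProbabilityMeasure_map (hX_meas n 0).aemeasurable
  have hregion := tendsto_mul_measureReal_polarPreimage hν hX_lim hp.isBounded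
    hp.measurableSet_region hp.null_frontier_region
  have hcell := fun l => tendsto_mul_measureReal_polarPreimage hν hX_lim
    (hp.isBounded.subset (hp.subset_region l)) (hp.measurableSet l) (hp.null_frontier l)
  have hblock := fun b : Fin m => tendsto_binomialPatternProb (fun n => measureReal_le_one) hregion
    hcell (tendsto_card_timeBlock_div h b) (q b)
  refine (tendsto_finsetProd Finset.univ fun b _ => hblock b).congr' ?_
  filter_upwards [eventually_ne_atTop 0] with n hn
  exact (measureReal_iInter_patternEvent (hX_meas n) (hX_indep n)
    (fun i => (hX_ident n i).map_eq) (fun l => polarPreimage_mono (hp.subset_region l))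
    (measurableSet_polarPreimage hp.measurableSet_region)
    (fun l => measurableSet_polarPreimage (hp.measurableSet l))
    ((pairwise_disjoint_timeBlock hn h).comp_of_injective Fin.val_injective) q).symm

end Array

section Poisson

variable {T : Type*} [TopologicalSpace T] [CompactSpace T] {κ : Type*} {m : ℕ}
  {S : Set (PolarSpace T)} {A : κ → Set (PolarSpace T)} {h : ℝ≥0} {Ω : Type*}

/-- The event that, for each `b < m`, the points of the random point measure `N` with time in the
time cell `b` have the pattern `q b`. -/
def pointPatternEvent (N : Ω → Measure (PolarSpace T × ℝ≥0)) (S : Set (PolarSpace T))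
    (A : κ → Set (PolarSpace T)) (h : ℝ≥0) (q : Fin m → Option κ) : Set Ω :=
  ⋂ b : Fin m, countPatternEvent N (S ×ˢ timeCell h b) (fun l => A l ×ˢ timeCell h b) (q b)

variable {ν : Measure (PolarSpace T)} {ε a : ℝ≥0} {g : κ → CPlus T}

theorem measureReal_prod_timeCell (D : Set (PolarSpace T)) (h : ℝ≥0) (b : ℕ) :
    (ν.prod lebesgueHalfLine).real (D ×ˢ timeCell h b) = h * ν.real D := by
  rw [measureReal_def, Measure.prod_prod, lebesgueHalfLine_timeCell, ENNReal.toReal_mul, mul_comm]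
  rfl

theorem measure_prod_timeCell_ne_top {D : Set (PolarSpace T)} (hD : ν D ≠ ∞)
    (h : ℝ≥0) (b : ℕ) : (ν.prod lebesgueHalfLine) (D ×ˢ timeCell h b) ≠ ∞ := by
  rw [Measure.prod_prod, lebesgueHalfLine_timeCell]
  exact ENNReal.mul_ne_top hD ENNReal.coe_ne_top

variable [MeasurableSpace Ω] {P : Measure Ω} {N : Ω → Measure (PolarSpace T × ℝ≥0)}

theorem IsPoissonPointProcess.measureReal_pointPatternEvent
    (hN : IsPoissonPointProcess N (ν.prod lebesgueHalfLine) P) (hS : MeasurableSet S)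
    (hνS : ν S ≠ ∞) (hA : ∀ l, MeasurableSet (A l)) (hAS : ∀ l, A l ⊆ S) (h : ℝ≥0)
    (q : Fin m → Option κ) :
    P.real (pointPatternEvent N S A h q) =
      ∏ b, poissonPatternProb (h * ν.real S) (fun l => h * ν.real (A l)) (q b) := by
  have hdisj : Pairwise (Function.onFun Disjoint fun b : Fin m => S ×ˢ timeCell h b) :=
    fun b b' hb => Set.disjoint_prod.2 <| .inr <| pairwise_disjoint_timeCell h <|
      Fin.val_injective.ne hb
  rw [pointPatternEvent, hN.measureReal_iInter_countPatternEvent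
    (S := fun b : Fin m => S ×ˢ timeCell h b) (A := fun b l => A l ×ˢ timeCell h b)
    (fun b => hS.prod measurableSet_timeCell) (fun b => measure_prod_timeCell_ne_top hνS h b) hdisj
    (fun b l => (hA l).prod measurableSet_timeCell) fun b l => Set.prod_mono_left (hAS l)]
  simp only [measureReal_prod_timeCell]

theorem IsPoissonPointProcess.measureReal_compl_iUnion_pointPatternEvent_le [Countable κ]
    [IsProbabilityMeasure P] (hN : IsPoissonPointProcess N (ν.prod lebesgueHalfLine) P)
    (hS : MeasurableSet S) (hνS : ν S ≠ ∞) (hA : ∀ l, MeasurableSet (A l))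
    (hAS : ∀ l, A l ⊆ S) (h : ℝ≥0) (m : ℕ) :
    P.real (⋃ q : Fin m → Option κ, pointPatternEvent N S A h q)ᶜ ≤
      m * (ν.real S * h) ^ 2 + m * h * ν.real (S \ ⋃ l, A l) := by
  refine (hN.measureReal_compl_iUnion_countPatternEvent_le
    (S := fun b : Fin m => S ×ˢ timeCell h b) (A := fun b l => A l ×ˢ timeCell h b)
    (fun b => hS.prod measurableSet_timeCell) (fun b => measure_prod_timeCell_ne_top hνS h b)
    (fun b l => (hA l).prod measurableSet_timeCell) fun b l =>
      Set.prod_mono_left (hAS l)).trans_eq ?_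
  simp only [← Set.iUnion_prod_const, Set.prod_sdiff_prod, Set.sdiff_self, Set.prod_empty,
    Set.empty_union, measureReal_prod_timeCell, Finset.sum_const, Finset.card_univ,
    Fintype.card_fin, nsmul_eq_mul]
  ring

theorem IsContinuityPartition.isDiscretisation_orderPath (hp : IsContinuityPartition ν ε S A g)
    [IsProbabilityMeasure P] (hN : IsPoissonPointProcess N (ν.prod lebesgueHalfLine) P)
    {I : Ω → Set ℕ}
    {x : (ω : Ω) → I ω → PolarSpace T × ℝ≥0}
    (hx : ∀ ω, LocallyFinitelyLarge fun i => ((x ω i).1.toCPlus, (x ω i).2))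
    (hNx : ∀ ω, N ω = Measure.sum fun i => Measure.dirac (x ω i)) (hh : 0 < h) (hhε : h ≤ ε)
    (ha : a ≤ m * h) (r : ℕ) :
    IsDiscretisation P (fun ω => orderPath (hx ω) r)
      (SkorokhodSpace.entourage (Fin r → CPlus T) a ε) (patternPath g h r)
      (pointPatternEvent (m := m) N S A h) where
  measurableSet q := MeasurableSet.iInter fun b => hN.measurableSet_countPatternEvent
    (hp.measurableSet_region.prod measurableSet_timeCell)
    (fun l => (hp.measurableSet l).prod measurableSet_timeCell) (q b)
  pairwise_disjoint := hN.pairwise_disjoint_iInter_countPatternEvent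
    (fun b l => Set.prod_mono_left (hp.subset_region l))
    fun b l l' hl => Set.disjoint_prod.2 (.inl (hp.pairwise_disjoint hl))
  ae_mem q := by
    have hcountable := Set.countable_range fun b : ℕ => (b : ℝ≥0) * h
    have hnull : (ν.prod lebesgueHalfLine) (S ×ˢ Set.range fun b : ℕ => (b : ℝ≥0) * h) = 0 := by
      rw [Measure.prod_prod, lebesgueHalfLine_eq_zero_of_countable hcountable, mul_zero]
    filter_upwards [hN.ae_eq_zero (hp.measurableSet_region.prod hcountable.measurableSet) hnull]
      with ω hgrid hω
    rw [hNx ω, sum_dirac_apply, ENat.toENNReal_eq_zero, Set.encard_eq_zero,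
      Set.eq_empty_iff_forall_notMem] at hgrid
    refine orderPath_patternPath_mem_entourage (φ := PolarSpace.toCPlus) (hx ω) hp.mem_region
      hp.subset_region hp.dist_le hh hhε ha (fun i hi b hb => hgrid i ⟨hi, b, hb.symm⟩)
      (fun b => ?_) r
    exact hasPattern_univ_prod_iff.1 <| (mem_countPatternEvent_iff
      (fun l => Set.prod_mono_left (hp.subset_region l)) (hNx ω) _).1 (Set.mem_iInter.1 hω b)

end Poisson

/-! ### Convergence of the order statistics -/

section Convergence

variable {T : Type*} [TopologicalSpace T] [CompactSpace T] [SecondCountableTopology C(T, ℝ≥0)]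
  {Ω : ℕ → Type*} [∀ n, MeasurableSpace (Ω n)] {P : (n : ℕ) → Measure (Ω n)}
  [∀ n, IsProbabilityMeasure (P n)] {X : (n : ℕ) → ℕ → Ω n → CPlus T} {ν : Measure (PolarSpace T)}
  {Ω' : Type*} [MeasurableSpace Ω'] {P' : Measure Ω'} [IsProbabilityMeasure P']
  {N : Ω' → Measure (PolarSpace T × ℝ≥0)}

theorem hasFiniteApproximation_arrayPath_orderPath (hX_meas : ∀ n i, Measurable (X n i))
    (hX_indep : ∀ n, iIndepFun (X n) (P n))
    (hX_ident : ∀ n i, IdentDistrib (X n i) (X n 0) (P n) (P n)) (hν : IsBoundedlyFinite ν)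
    (hX_lim : TendstoSharpWeakly
      (fun n => (n : ℝ≥0∞) • polarMeasure ((P n).map (X n 0))) ν)
    (hν_top : ν {p | p.radius = ∞} = 0)
    (hN : IsPoissonPointProcess N (ν.prod lebesgueHalfLine) P') {I : Ω' → Set ℕ}
    {x : (ω : Ω') → I ω → PolarSpace T × ℝ≥0}
    (hx : ∀ ω, LocallyFinitelyLarge fun i => ((x ω i).1.toCPlus, (x ω i).2))
    (hNx : ∀ ω, N ω = Measure.sum fun i => Measure.dirac (x ω i)) {r : ℕ}
    {V : Set (SkorokhodSpace (Fin r → CPlus T) × SkorokhodSpace (Fin r → CPlus T))}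
    (hV : V ∈ uniformity (SkorokhodSpace (Fin r → CPlus T))) {η : ℝ} (hη : 0 < η) :
    HasFiniteApproximation P (fun n ω => arrayPath n r fun i => X n i ω) P'
      (fun ω => orderPath (hx ω) r) V η := by
  obtain ⟨⟨a, ε⟩, hε, hVsub⟩ := (SkorokhodSpace.hasBasis_uniformity _).mem_iff.1 hV
  obtain ⟨L, S, A, g, hp, hleft⟩ := exists_isContinuityPartition hν hν_top hε
    (δ := η / (2 * (a + 1))) (by positivity)
  obtain ⟨h, m, hh, hirr, hhε, ha, hma, hsq⟩ :=
    exists_irrational_mesh a hε (ν.real S) (half_pos hη)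
  have hνS : ν S ≠ ∞ := (hν S hp.isBounded hp.measurableSet_region).ne
  refine ⟨Fin m → Option (Fin L), inferInstance, patternPath g h r,
    fun n => arrayPatternEvent (X n) S A h n, pointPatternEvent N S A h, ?_,
    (hp.isDiscretisation_orderPath hN hx hNx hh hhε ha r).mono hVsub, fun q => ?_, ?_⟩
  · filter_upwards [eventually_ne_atTop 0] with n hn
    exact (hp.isDiscretisation_arrayPath (P n) (hX_meas n) hh hirr hhε ha r hn).mono hVsub
  · rw [hN.measureReal_pointPatternEvent hp.measurableSet_region hνS hp.measurableSet
      hp.subset_region]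
    exact hp.tendsto_measureReal_arrayPatternEvent hX_meas hX_indep hX_ident hν hX_lim h q
  · calc P'.real (⋃ q : Fin m → Option (Fin L), pointPatternEvent N S A h q)ᶜ
        ≤ m * (ν.real S * h) ^ 2 + m * h * ν.real (S \ ⋃ l, A l) :=
          hN.measureReal_compl_iUnion_pointPatternEvent_le hp.measurableSet_region hνS
            hp.measurableSet hp.subset_region h m
      _ ≤ η / 2 + (a + 1) * (η / (2 * (a + 1))) := by gcongr
      _ = η := by field_simp; norm_num

end Convergence

theorem theorem3_general {T : Type*} [TopologicalSpace T] [CompactSpace T]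
    [SecondCountableTopology C(T, ℝ≥0)]
    {Ω : ℕ → Type*} [∀ n, MeasurableSpace (Ω n)]
    (P : (n : ℕ) → Measure (Ω n)) [∀ n, IsProbabilityMeasure (P n)]
    (X : (n : ℕ) → ℕ → Ω n → CPlus T)
    (hX_meas : ∀ n i, Measurable (X n i))
    (hX_indep : ∀ n, iIndepFun (X n) (P n))
    (hX_ident : ∀ n i, IdentDistrib (X n i) (X n 0) (P n) (P n))
    (ν : Measure (PolarSpace T)) (hν : IsBoundedlyFinite ν)
    (hX_lim : TendstoSharpWeakly
      (fun n => (n : ℝ≥0∞) • polarMeasure ((P n).map (X n 0))) ν)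
    (hν_top : ν {p | p.radius = ∞} = 0) (r : ℕ)
    {Ω' : Type*} [MeasurableSpace Ω'] (P' : Measure Ω') [IsProbabilityMeasure P']
    (N : Ω' → Measure (PolarSpace T × ℝ≥0))
    (hN : IsPoissonPointProcess N (ν.prod lebesgueHalfLine) P') :
    ∃ (M : (n : ℕ) → Ω n → SkorokhodSpace (Fin r → CPlus T))
      (M' : Ω' → SkorokhodSpace (Fin r → CPlus T)),
      (∀ n ω u (j : Fin r) t, M n ω u j t =
        nthLargest ((Multiset.range ⌊(n : ℝ≥0) * u⌋₊).map fun i => X n i ω t) j) ∧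
      (∀ ω u (j : Fin r) t, M' ω u j t = spaceTimeOrderStat (N ω) j u t) ∧
      TendstoInDistribution M atTop M' P P' := by
  choose I x hxfin hNx using hN.pointMeasure
  have hx : ∀ ω, LocallyFinitelyLarge fun i => ((x ω i).1.toCPlus, (x ω i).2) := fun ω =>
    locallyFinitelyLarge_of_finite_preimage (hxfin ω)
  have harray : ∀ n, AEMeasurable (fun ω => arrayPath n r fun i => X n i ω) (P n) := fun n =>
    ((continuous_arrayPath (T := T) n r).measurable.comp
      (measurable_pi_lambda _ (hX_meas n))).aemeasurable
  refine ⟨fun n ω => arrayPath n r fun i => X n i ω, fun ω => orderPath (hx ω) r,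
    fun n ω u j t => arrayPath_apply n _ u j t, fun ω u j t => ?_,
    tendstoInDistribution_of_hasFiniteApproximation harray fun V hV η hη =>
      hasFiniteApproximation_arrayPath_orderPath hX_meas hX_indep hX_ident hν hX_lim hν_top hN hx
        hNx hV hη⟩
  rw [orderPath_apply, hNx ω, spaceTimeOrderStat_sum_dirac]

end

/-- Row `n` of the array lives on its own probability space `(Ω n, P n)`, and `X n i` stands for
the `(i+1)`-th process of that row, so that the first `[nu]` processes of row `n` are `X n i` with
`i < [nu]`. -/
theorem theorem3 {T : Type*} [MetricSpace T] [CompactSpace T]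
    {Ω : ℕ → Type*} [∀ n, MeasurableSpace (Ω n)]
    (P : (n : ℕ) → Measure (Ω n)) [∀ n, IsProbabilityMeasure (P n)]
    (X : (n : ℕ) → ℕ → Ω n → CPlus T)
    (hX_meas : ∀ n i, Measurable (X n i))
    (hX_indep : ∀ n, iIndepFun (X n) (P n))
    (hX_ident : ∀ n i, IdentDistrib (X n i) (X n 0) (P n) (P n))
    (ν : Measure (PolarSpace T)) (hν : IsBoundedlyFinite ν)
    (hX_lim : TendstoSharpWeakly
      (fun n => (n : ℝ≥0∞) • polarMeasure ((P n).map (X n 0))) ν)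
    (hν_top : ν {p | p.radius = ∞} = 0)
    (r : ℕ) (hr : 1 ≤ r)
    {Ω' : Type*} [MeasurableSpace Ω'] (P' : Measure Ω') [IsProbabilityMeasure P']
    (N : Ω' → Measure (PolarSpace T × ℝ≥0))
    (hN : IsPoissonPointProcess N (ν.prod lebesgueHalfLine) P') :
    ∃ (M : (n : ℕ) → Ω n → SkorokhodSpace (Fin r → CPlus T))
      (M' : Ω' → SkorokhodSpace (Fin r → CPlus T)),
      (∀ n ω u (j : Fin r) t, M n ω u j t =
        nthLargest ((Multiset.range ⌊(n : ℝ≥0) * u⌋₊).map fun i => X n i ω t) j) ∧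
      (∀ ω u (j : Fin r) t, M' ω u j t = spaceTimeOrderStat (N ω) j u t) ∧
      TendstoInDistribution M atTop M' P P' :=
  theorem3_general P X hX_meas hX_indep hX_ident ν hν hX_lim hν_top r P' N hN
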